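/- **Theorem 1.** Let $m\ge 2$, $n\ge 1$, and let $\mathcal G$ be an undirected connected graph on $\{1,\dots,m\}$ with Laplacian matrix $\mathbf L=(\ell_{ij})\in\mathbb R^{m\times m}$. Let $\sqrt{\mathbf L}=(\tilde\ell_{ij})$ be its positive semidefinite square root, $\|\sqrt{\mathbf L}\|$ the spectral norm of that root, $\sqrt{\hat{\mathbf L}}=\sqrt{\mathbf L}\otimes \mathbf I_n$, and $\lambda_{\min}^+(\mathbf L)$ the smallest non-zero eigenvalue of $\mathbf L$. Let $f_1,\dots,f_m:\mathbb R^n\to\mathbb R$ be twice continuously differentiable and coercive, with $\nabla f_i$ being $L^g_{f_i}$-Lipschitz and $\nabla^2 f_i$ being $L^H_{f_i}$-Lipschitz. Put $L_F^g=\max_i L^g_{f_i}$, $L_F^H=\max_i L^H_{f_i}$, $f_i^\star=\min f_i$ and $F(\boldsymbol\theta)=\sum_{i=1}^m f_i(\boldsymbol\theta_i)$ for $\boldsymbol\theta\in(\mathbb R^n)^m$. Let $\epsilon_g>0$, $\epsilon_H=\sqrt{\epsilon_g\,\|\sqrt{\mathbf L}\|^{3}L_F^H}$ and $0<p<1$.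 Then there exists $$0<\bar\alpha\le\min\Big\{\frac{1}{\|\sqrt{\mathbf L}\|^2L_F^g},\;-\frac{2\ln p}{\|\sqrt{\mathbf L}\|^2L_F^g}\Big\}$$ such that the following holds for every step size $0<\alpha\le\bar\alpha$, every $\mathbf r\in\mathbb R^n$ and every $\boldsymbol\theta^0\in(\mathbb R^n)^m$ with $\sum_i\boldsymbol\theta^0_i=\mathbf r$ and $F(\boldsymbol\theta^0)>\sum_i f_i^\star$. Let $\mathbf n_i^k$ ($k\ge 0$, $1\le i\le m$) be independent random vectors with law $\mathcal N(\mathbf 0,\sigma^2\mathbf I_n)$, where $\sigma^2=\epsilon_g^2/(12mn)$, and let $\{\boldsymbol\theta^k\}$ be generated by noisy Laplacian-weighted gradient descent (NLGD), $$\boldsymbol\theta_i^{k+1}=\boldsymbol\theta_i^k-\alpha\sum_{j=1}^m\big(\ell_{ij}\nabla f_j(\boldsymbol\theta_j^k)+\tilde\ell_{ij}\mathbf n_j^k\big),\qquad k\ge 0 .$$ Then, with $$K=\Big\lceil\frac{F(\boldsymbol\theta^0)-\sum_{i=1}^m f_i^\star}{\|\sqrt{\mathbf L}\|^2L_F^g\,\epsilon_g^2\,\alpha^2}\Big\rceil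 ,$$ with probability at least $1-p$ there is an integer $k\in(0,K]$ such that $\|\sqrt{\hat{\mathbf L}}\,\nabla F(\boldsymbol\theta^k)\|\le\epsilon_g$, $\sum_i\boldsymbol\theta_i^k=\mathbf r$, and $$\mathbf d^\top\nabla^2F(\boldsymbol\theta^k)\,\mathbf d\ge-\frac{\epsilon_H}{\lambda_{\min}^+(\mathbf L)}\|\mathbf d\|^2\quad\text{for all }\mathbf d\in(\mathbb R^n)^m\text{ with }\sum_i\mathbf d_i=\mathbf 0 .$$ -/

import Mathlib

open MeasureTheory ProbabilityTheory Filter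
open scoped NNReal ENNReal MatrixOrder

noncomputable section

namespace NLGD

/-- The space `(ℝⁿ)ᵐ` of stacked decision vectors, with its Euclidean norm. -/
abbrev Stack (m n : ℕ) : Type := PiLp 2 (fun _ : Fin m => EuclideanSpace ℝ (Fin n))

/-- The action of `A ⊗ I_n` on `(ℝⁿ)ᵐ`: the `i`-th block of the result is `∑ j, A i j • v j`. -/
def kronAct {m n : ℕ} (A : Matrix (Fin m) (Fin m) ℝ) (v : Stack m n) : Stack m n :=
  WithLp.toLp 2 fun i => ∑ j, A i j • v j

/-- The separable objective `F θ = ∑ i, f_i (θ_i)`. -/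
def objective {m n : ℕ} (f : Fin m → EuclideanSpace ℝ (Fin n) → ℝ) (θ : Stack m n) : ℝ :=
  ∑ i, f i (θ i)

/-- The positive semidefinite square root of the graph Laplacian. -/
def sqrtLap {m : ℕ} (G : SimpleGraph (Fin m)) [DecidableRel G.Adj] : Matrix (Fin m) (Fin m) ℝ :=
  CFC.sqrt (G.lapMatrix ℝ)

/-- The spectral norm of a square real matrix (operator norm for the Euclidean norm). -/
def specNorm {m : ℕ} (A : Matrix (Fin m) (Fin m) ℝ) : ℝ :=
  ‖Matrix.toEuclideanCLM (𝕜 := ℝ) A‖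

/-- The smallest non-zero eigenvalue of a positive semidefinite matrix. -/
def lambdaMinPos {m : ℕ} (A : Matrix (Fin m) (Fin m) ℝ) : ℝ :=
  sInf {μ : ℝ | μ ≠ 0 ∧ Module.End.HasEigenvalue (Matrix.toLin' A) μ}

/-- `θ` is an `(ε, γ)`-second-order optimal solution of the problem of minimizing
`∑ i, f_i (θ_i)` subject to `∑ i, θ_i = r`, over the network `G`. -/
structure IsSecondOrderOptimal {m n : ℕ} (G : SimpleGraph (Fin m)) [DecidableRel G.Adj]
    (f : Fin m → EuclideanSpace ℝ (Fin n) → ℝ) (r : EuclideanSpace ℝ (Fin n))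
    (ε γ : ℝ) (θ : Stack m n) : Prop where
  grad_le : ‖kronAct (sqrtLap G) (gradient (objective f) θ)‖ ≤ ε
  feasible : ∑ i, θ i = r
  hess_ge : ∀ d : Stack m n, ∑ i, d i = 0 →
    -γ * ‖d‖ ^ 2 ≤ inner ℝ d (fderiv ℝ (gradient (objective f)) θ d)

/-- The iterates of noisy Laplacian-weighted gradient descent with step size `α`, initial point
`θ0` and perturbations `w k j` (iteration `k`, agent `j`). -/
def iterate {m n : ℕ} (G : SimpleGraph (Fin m)) [DecidableRel G.Adj]
    (f : Fin m → EuclideanSpace ℝ (Fin n) → ℝ) (α : ℝ) (θ0 : Stack m n)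
    (w : ℕ → Fin m → EuclideanSpace ℝ (Fin n)) : ℕ → Stack m n
  | 0 => θ0
  | k + 1 => WithLp.toLp 2 fun i =>
      iterate G f α θ0 w k i - α • ∑ j, (G.lapMatrix ℝ i j • gradient (f j) (iterate G f α θ0 w k j)
        + sqrtLap G i j • w k j)

end NLGD

end

/-! Write `θ = θ0 + (√L ⊗ I) x`. Since `√L · √L = L`, the network iteration becomes gradient descent
on `g x = F (θ0 + (√L ⊗ I) x)` with isotropic Gaussian noise, started at `x = 0`. Columns of `√L`
sum to zero, so feasibility is automatic; `∇g` is `(√L ⊗ I) ∇F`, and on a connected graph every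
zero-sum `d` is some `(√L ⊗ I) y`, so a violated Hessian condition becomes negative curvature of
`g`. Only the positivity of the resulting curvature bound matters, and likewise of the noise
variance: the step size absorbs all constants. The Lipschitz bounds for `g` do not depend on `θ0`,
hence neither does the step size.

The core is `exists_stepSize`. The excess `V = g - gs` is a Lyapunov function: outside the good set
its mean falls at any prescribed rate `q α²` per step, over some horizon of at most `O(1/α)` steps.
If `‖∇g‖²` exceeds a multiple of `α`, one step suffices (`lintegral_step_le`). Otherwise the point
is a near-saddle and `saddle_drift` applies: along an eigenvector of negative curvature the noise
makes the second moment of a linear model of the gradient grow by order `α²` per step. After `t/α`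
steps the accumulated gain is of order `t² α`, against a noise cost of order `t α`, so a large
constant `t` wins; the fourth moment of the displacement controls the linearization error. No
exponential escape is needed.

The drift bounds the survival probability outside the good set (`mul_survival_le`). This is useful
when `V x0` is not small; when it is small, Markov's inequality at time 1 suffices, because bad
points have `V` bounded below. -/

namespace NLGD

/-! ### Smooth functions: descent, curvature and eigenvectors -/

section Smooth

variable {E : Type*} [NormedAddCommGroup E] [InnerProductSpace ℝ E] [CompleteSpace E]

/-- A function `g` with gradient `g'` and Hessian `H`, both Lipschitz, which is bounded below
by `gs`. -/
structure IsSmoothBelow (g : E → ℝ) (g' : E → E) (H : E → E →L[ℝ] E) (L ρ gs : ℝ) : Prop where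
  hasGradient : ∀ x, HasGradientAt g (g' x) x
  hasHessian : ∀ x, HasFDerivAt g' (H x) x
  gradient_lip : ∀ x y, ‖g' x - g' y‖ ≤ L * ‖x - y‖
  hessian_lip : ∀ x y, ‖H x - H y‖ ≤ ρ * ‖x - y‖
  hessian_symm : ∀ x, (H x : E →ₗ[ℝ] E).IsSymmetric
  below : ∀ x, gs ≤ g x

namespace IsSmoothBelow

variable {g : E → ℝ} {g' : E → E} {H : E → E →L[ℝ] E} {L ρ gs : ℝ}

theorem continuous (h : IsSmoothBelow g g' H L ρ gs) : Continuous g :=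
  continuous_iff_continuousAt.2 fun x => (h.hasGradient x).continuousAt

theorem continuous_gradient (h : IsSmoothBelow g g' H L ρ gs) : Continuous g' :=
  continuous_iff_continuousAt.2 fun x => (h.hasHessian x).continuousAt

theorem norm_hessian_le (h : IsSmoothBelow g g' H L ρ gs) (hL : 0 ≤ L) (x : E) : ‖H x‖ ≤ L :=
  (h.hasHessian x).le_of_lip' hL (Eventually.of_forall fun y => h.gradient_lip y x)

/-- Descent inequality. -/
theorem apply_add_le (h : IsSmoothBelow g g' H L ρ gs) (hL : 0 ≤ L) (x y : E) :
    g (x + y) ≤ g x + inner ℝ (g' x) y + L * ‖y‖ ^ 2 := by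
  have key := (convex_closedBall x ‖y‖).norm_image_sub_le_of_norm_hasFDerivWithin_le'
    (f := g) (f' := fun z => InnerProductSpace.toDual ℝ E (g' z))
    (φ := InnerProductSpace.toDual ℝ E (g' x)) (C := L * ‖y‖) (x := x) (y := x + y)
    (fun z _ => (h.hasGradient z).hasFDerivAt.hasFDerivWithinAt)
    (fun z hz => by
      rw [← map_sub, LinearIsometryEquiv.norm_map]
      refine (h.gradient_lip z x).trans ?_
      rw [mem_closedBall_iff_norm] at hz
      gcongr)
    (by simp) (by simp)
  simp only [add_sub_cancel_left, InnerProductSpace.toDual_apply_apply, Real.norm_eq_abs] at key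
  have := (abs_le.1 key).2
  nlinarith

theorem norm_gradient_sub_hessian_le (h : IsSmoothBelow g g' H L ρ gs) (hρ : 0 ≤ ρ) (x y : E) :
    ‖g' (x + y) - g' x - H x y‖ ≤ ρ * ‖y‖ ^ 2 := by
  have key := (convex_closedBall x ‖y‖).norm_image_sub_le_of_norm_hasFDerivWithin_le'
    (f := g') (f' := H) (φ := H x) (C := ρ * ‖y‖) (x := x) (y := x + y)
    (fun z _ => (h.hasHessian z).hasFDerivWithinAt)
    (fun z hz => by
      refine (h.hessian_lip z x).trans ?_
      rw [mem_closedBall_iff_norm] at hz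
      gcongr)
    (by simp) (by simp)
  simp only [add_sub_cancel_left] at key
  nlinarith

/-- The descent inequality at the step `-g' x / (2L)`, which minimizes its right-hand side, cannot
go below `gs`. It shows that a large gradient forces a value well above the infimum. -/
theorem norm_gradient_sq_le (h : IsSmoothBelow g g' H L ρ gs) (hL : 0 < L) (x : E) :
    ‖g' x‖ ^ 2 ≤ 4 * L * (g x - gs) := by
  have h1 := h.apply_add_le hL.le x (-(1 / (2 * L)) • g' x)
  have h2 := h.below (x + -(1 / (2 * L)) • g' x)
  rw [inner_smul_right, real_inner_self_eq_norm_sq, norm_smul, mul_pow, Real.norm_eq_abs,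
    sq_abs] at h1
  have h4 : -(1 / (2 * L)) * ‖g' x‖ ^ 2 + L * ((-(1 / (2 * L))) ^ 2 * ‖g' x‖ ^ 2)
      = - (‖g' x‖ ^ 2 / (4 * L)) := by field_simp; ring
  have h5 : ‖g' x‖ ^ 2 / (4 * L) ≤ g x - gs := by linarith
  rw [div_le_iff₀ (by positivity)] at h5
  linarith

/-- At a point with a direction of curvature below `-γ` the function is well above its infimum. -/
theorem le_of_curvature (h : IsSmoothBelow g g' H L ρ gs) (hρ : 0 ≤ ρ) {γ s : ℝ}
    (hs : 0 ≤ s) (hsγ : 4 * ρ * s ≤ γ) {x d : E} (hd : inner ℝ d (H x d) ≤ -γ * ‖d‖ ^ 2)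
    (hd1 : ‖d‖ = 1) : γ * s ^ 2 / 4 ≤ g x - gs := by
  -- Curvature is even in `d`, so `d` may be taken not to be an ascent direction.
  wlog hsgn : inner ℝ (g' x) d ≤ 0 generalizing d
  · exact this (d := -d) (by simpa using hd) (by simpa using hd1)
      (by rw [inner_neg_right]; linarith)
  rw [hd1] at hd
  have hder : ∀ u : ℝ, HasDerivAt (fun u : ℝ => g (x + u • d) + γ * u ^ 2 / 4)
      (inner ℝ (g' (x + u • d)) d + γ * u / 2) u := by
    intro u
    have h1 : HasDerivAt (fun u : ℝ => x + u • d) d u := by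
      simpa using ((hasDerivAt_id u).smul_const d).const_add x
    have h2 := (h.hasGradient (x + u • d)).hasFDerivAt.comp_hasDerivAt u h1
    simp only [InnerProductSpace.toDual_apply_apply] at h2
    have h3 : HasDerivAt (fun u : ℝ => γ * u ^ 2 / 4) (γ * u / 2) u := by
      refine (((hasDerivAt_pow 2 u).const_mul γ).div_const 4).congr_deriv ?_
      norm_num
      ring
    exact h2.add h3
  -- On `[0, s]` the slope of `g` along `d` is at most `-γ u + ρ u²`, and `ρ u² ≤ γ u / 4`; hence
  -- `g` loses at least `γ s² / 4` over the segment.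
  have hanti : AntitoneOn (fun u : ℝ => g (x + u • d) + γ * u ^ 2 / 4) (Set.Icc 0 s) := by
    refine antitoneOn_of_deriv_nonpos (convex_Icc 0 s)
      (fun u _ => (hder u).continuousAt.continuousWithinAt)
      (fun u _ => (hder u).differentiableAt.differentiableWithinAt) fun u hu => ?_
    rw [interior_Icc] at hu
    rw [(hder u).deriv]
    have h1 := h.norm_gradient_sub_hessian_le hρ x (u • d)
    have h2 := (real_inner_le_norm (g' (x + u • d) - g' x - H x (u • d)) d)
    rw [hd1, mul_one, inner_sub_left, inner_sub_left, map_smul, inner_smul_left,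
      real_inner_comm d (H x d)] at h2
    rw [norm_smul, hd1, mul_one, Real.norm_eq_abs, sq_abs] at h1
    simp only [conj_trivial] at h2
    have h3 : u * inner ℝ d (H x d) ≤ u * (-γ * 1 ^ 2) := mul_le_mul_of_nonneg_left hd hu.1.le
    have h4 : ρ * u ^ 2 ≤ ρ * s * u := by
      have := mul_le_mul_of_nonneg_left hu.2.le (mul_nonneg hρ hu.1.le)
      linarith
    have h5 := mul_le_mul_of_nonneg_right hsγ hu.1.le
    have h6 : 0 ≤ ρ * s * u := mul_nonneg (mul_nonneg hρ hs) hu.1.le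
    rw [map_smul] at h1
    linarith
  have h1 := hanti (Set.left_mem_Icc.2 hs) (Set.right_mem_Icc.2 hs) hs
  have h2 := h.below (x + s • d)
  simp only [zero_smul, add_zero] at h1
  norm_num at h1
  linarith

end IsSmoothBelow

omit [CompleteSpace E] in
/-- A symmetric operator whose quadratic form is below `-γ` somewhere has a unit eigenvector
with eigenvalue below `-γ`. -/
theorem exists_unit_eigenvector_of_inner_lt [FiniteDimensional ℝ E] {T : E →L[ℝ] E}
    (hT : (T : E →ₗ[ℝ] E).IsSymmetric) {γ : ℝ} {d : E} (hd : inner ℝ d (T d) < -γ * ‖d‖ ^ 2) :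
    ∃ e : E, ‖e‖ = 1 ∧ ∃ η, γ ≤ η ∧ T e = -η • e := by
  have hd0 : d ≠ 0 := by rintro rfl; simp at hd
  have : Nontrivial E := ⟨d, 0, hd0⟩
  -- The infimum of the Rayleigh quotient is an eigenvalue, and `d` shows that it lies below `-γ`.
  have hev := hT.hasEigenvalue_iInf_of_finiteDimensional
  simp only [RCLike.re_to_real, RCLike.ofReal_real_eq_id, id] at hev
  set μ : ℝ := ⨅ x : {x : E // x ≠ 0}, inner ℝ ((T : E →ₗ[ℝ] E) ↑x) (x : E) / ‖(x : E)‖ ^ 2 with hμ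
  obtain ⟨v, hv⟩ := hev.exists_hasEigenvector
  have hvm : T v = μ • v := hv.apply_eq_smul
  have hv0 : ‖v‖ ≠ 0 := norm_ne_zero_iff.2 hv.2
  have hbdd : BddBelow (Set.range fun x : {x : E // x ≠ 0} =>
      inner ℝ ((T : E →ₗ[ℝ] E) ↑x) (x : E) / ‖(x : E)‖ ^ 2) := by
    refine ⟨-‖T‖, ?_⟩
    rintro _ ⟨x, rfl⟩
    have hx : 0 < ‖(x : E)‖ := norm_pos_iff.2 x.2
    show -‖T‖ ≤ inner ℝ (T (x : E)) (x : E) / ‖(x : E)‖ ^ 2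
    rw [le_div_iff₀ (by positivity)]
    have h1 := (abs_le.1 (abs_real_inner_le_norm (T (x : E)) (x : E))).1
    have h2 := T.le_opNorm (x : E)
    nlinarith
  have hle : μ ≤ inner ℝ (T d) d / ‖d‖ ^ 2 := ciInf_le hbdd ⟨d, hd0⟩
  have hdn : 0 < ‖d‖ := norm_pos_iff.2 hd0
  have hlt : inner ℝ (T d) d / ‖d‖ ^ 2 < -γ := by
    rw [div_lt_iff₀ (by positivity), real_inner_comm]; exact hd
  refine ⟨‖v‖⁻¹ • v, ?_, -μ, by linarith, ?_⟩
  · rw [norm_smul, norm_inv, norm_norm, inv_mul_cancel₀ hv0]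
  · rw [map_smul, hvm, smul_comm, neg_neg]

end Smooth

/-! ### Moment estimates for one noisy step -/

section Noise

variable {E : Type*} [NormedAddCommGroup E] [InnerProductSpace ℝ E]
  [MeasurableSpace E]

/-- A centred law on `E` with finite fourth moment and variance `s2` in every unit direction. -/
structure IsNoise (μ : Measure E) (M2 M4 s2 : ℝ) : Prop where
  isProbabilityMeasure : IsProbabilityMeasure μ
  memLp : MemLp (fun n : E => n) 4 μ
  mean : ∀ u : E, ∫ n, inner ℝ u n ∂μ = 0
  second : ∫ n, ‖n‖ ^ 2 ∂μ = M2
  fourth : ∫ n, ‖n‖ ^ 4 ∂μ = M4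
  direction : ∀ e : E, ‖e‖ = 1 → ∫ n, (inner ℝ e n) ^ 2 ∂μ = s2

/-- One step of gradient descent perturbed by `n`. -/
def step (α : ℝ) (g' : E → E) (x n : E) : E := x - α • (g' x + n)

namespace IsNoise

variable {μ : Measure E} {M2 M4 s2 : ℝ}

theorem integrable_norm_four (hμ : IsNoise μ M2 M4 s2) : Integrable (fun n : E => ‖n‖ ^ 4) μ := by
  have := hμ.isProbabilityMeasure
  exact hμ.memLp.integrable_norm_pow (by norm_num)

theorem integrable_norm_sq (hμ : IsNoise μ M2 M4 s2) : Integrable (fun n : E => ‖n‖ ^ 2) μ := by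
  have := hμ.isProbabilityMeasure
  exact (hμ.memLp.mono_exponent (p := 2) (by norm_num)).integrable_norm_pow (by norm_num)

theorem integrable_inner (hμ : IsNoise μ M2 M4 s2) (u : E) :
    Integrable (fun n : E => inner ℝ u n) μ := by
  have := hμ.isProbabilityMeasure
  have h1 : Integrable (fun n : E => n) μ := memLp_one_iff_integrable.1
    (hμ.memLp.mono_exponent (by norm_num))
  exact (innerSL ℝ u).integrable_comp h1

theorem second_nonneg (hμ : IsNoise μ M2 M4 s2) : 0 ≤ M2 := by
  rw [← hμ.second]; positivity

theorem fourth_nonneg (hμ : IsNoise μ M2 M4 s2) : 0 ≤ M4 := by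
  rw [← hμ.fourth]; positivity

variable [BorelSpace E] [SecondCountableTopology E]

theorem integrable_inner_sq (hμ : IsNoise μ M2 M4 s2) (u : E) :
    Integrable (fun n : E => (inner ℝ u n) ^ 2) μ := by
  refine (hμ.integrable_norm_sq.const_mul (‖u‖ ^ 2)).mono' (by fun_prop) ?_
  refine Eventually.of_forall fun n => ?_
  rw [Real.norm_eq_abs, abs_of_nonneg (sq_nonneg _), ← mul_pow]
  exact sq_le_sq' (abs_le.1 (abs_real_inner_le_norm u n)).1 (real_inner_le_norm u n)

end IsNoise

/-- An integrable majorant is enough: integrability of the objective after a step never has to be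
established. -/
theorem lintegral_ofReal_le_of_le {Ω : Type*} [MeasurableSpace Ω] {μ : Measure Ω} {h k : Ω → ℝ}
    (hk : Integrable k μ) (hk0 : 0 ≤ k) (hle : ∀ ω, h ω ≤ k ω) :
    ∫⁻ ω, ENNReal.ofReal (h ω) ∂μ ≤ ENNReal.ofReal (∫ ω, k ω ∂μ) := by
  rw [ofReal_integral_eq_lintegral_ofReal hk (Eventually.of_forall hk0)]
  exact lintegral_mono fun ω => ENNReal.ofReal_le_ofReal (hle ω)

variable [BorelSpace E] [SecondCountableTopology E] [CompleteSpace E] {μ : Measure E} {M2 M4 s2 : ℝ}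
  {g : E → ℝ} {g' : E → E} {H : E → E →L[ℝ] E} {L ρ gs α : ℝ}

omit [BorelSpace E] [SecondCountableTopology E] in
/-- Expected decrease of the objective in one perturbed gradient step. -/
theorem IsSmoothBelow.lintegral_step_le (h : IsSmoothBelow g g' H L ρ gs)
    (hμ : IsNoise μ M2 M4 s2) (hL : 0 < L) (hα : 0 < α) (hαL : 4 * L * α ≤ 1) (x : E) :
    ∫⁻ n, ENNReal.ofReal (g (step α g' x n) - gs) ∂μ + ENNReal.ofReal (α / 2 * ‖g' x‖ ^ 2)
      ≤ ENNReal.ofReal (g x - gs) + ENNReal.ofReal (L * α ^ 2 * M2) := by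
  have := hμ.isProbabilityMeasure
  have hM2 := hμ.second_nonneg
  set k : E → ℝ := fun n => (g x - gs - α * ‖g' x‖ ^ 2 + L * α ^ 2 * ‖g' x‖ ^ 2)
    + inner ℝ ((-α + 2 * L * α ^ 2) • g' x) n + L * α ^ 2 * ‖n‖ ^ 2 with hk
  have hle : ∀ n, g (step α g' x n) - gs ≤ k n := by
    intro n
    have h1 := h.apply_add_le hL.le x (-(α • (g' x + n)))
    rw [← sub_eq_add_neg, norm_neg, norm_smul, mul_pow, Real.norm_eq_abs, sq_abs,
      norm_add_sq_real, inner_neg_right, inner_smul_right, inner_add_right,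
      real_inner_self_eq_norm_sq] at h1
    simp only [hk, step, inner_smul_left, conj_trivial]
    linarith
  have hk0 : 0 ≤ k := fun n => (sub_nonneg.2 (h.below _)).trans (hle n)
  have hi1 : Integrable (fun n => (g x - gs - α * ‖g' x‖ ^ 2 + L * α ^ 2 * ‖g' x‖ ^ 2)
      + inner ℝ ((-α + 2 * L * α ^ 2) • g' x) n) μ :=
    (integrable_const _).add (hμ.integrable_inner _)
  have hki : Integrable k μ := hi1.add (hμ.integrable_norm_sq.const_mul _)
  have hint : ∫ n, k n ∂μ = (g x - gs - α * ‖g' x‖ ^ 2 + L * α ^ 2 * ‖g' x‖ ^ 2)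
      + L * α ^ 2 * M2 := by
    simp only [hk]
    rw [integral_add hi1 (hμ.integrable_norm_sq.const_mul _), integral_add (integrable_const _)
      (hμ.integrable_inner _), hμ.mean, integral_const_mul, hμ.second]
    simp
  have hb := h.below x
  refine (add_le_add_left (lintegral_ofReal_le_of_le hki hk0 hle) _).trans ?_
  have hpos : 0 ≤ ∫ n, k n ∂μ := integral_nonneg hk0
  rw [← ENNReal.ofReal_add hpos (by positivity),
    ← ENNReal.ofReal_add (sub_nonneg.2 hb) (by positivity), hint]
  refine ENNReal.ofReal_le_ofReal ?_
  have h1 : L * α ^ 2 * ‖g' x‖ ^ 2 ≤ α / 4 * ‖g' x‖ ^ 2 := by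
    have : L * α ^ 2 ≤ α / 4 := by nlinarith
    gcongr
  have h2 : 0 ≤ α * ‖g' x‖ ^ 2 := by positivity
  linarith

/-- The linear model, around `x0`, of the component of the gradient along an eigenvector `e` of
the Hessian with eigenvalue `-η`. -/
def linModel (g' : E → E) (x0 e : E) (η : ℝ) (x : E) : ℝ := inner ℝ e (g' x0) - η * inner ℝ e (x - x0)

omit [MeasurableSpace E] [BorelSpace E] [SecondCountableTopology E] in
theorem IsSmoothBelow.abs_inner_gradient_sub_linModel_le (h : IsSmoothBelow g g' H L ρ gs)
    (hρ : 0 ≤ ρ) {x0 e : E} {η : ℝ} (he : ‖e‖ = 1) (hHe : H x0 e = -η • e) (x : E) :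
    |inner ℝ e (g' x) - linModel g' x0 e η x| ≤ ρ * ‖x - x0‖ ^ 2 := by
  have h1 := h.norm_gradient_sub_hessian_le hρ x0 (x - x0)
  rw [add_sub_cancel] at h1
  have h2 : inner ℝ e (H x0 (x - x0)) = -η * inner ℝ e (x - x0) := by
    have := h.hessian_symm x0 e (x - x0)
    simp only [ContinuousLinearMap.coe_coe] at this
    rw [← this, hHe, inner_smul_left, conj_trivial]
  have h3 : inner ℝ e (g' x) - linModel g' x0 e η x
      = inner ℝ e (g' x - g' x0 - H x0 (x - x0)) := by
    rw [inner_sub_right, inner_sub_right, h2, linModel]; ring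
  rw [h3]
  refine (abs_real_inner_le_norm _ _).trans ?_
  rwa [he, one_mul]

/-- The second moment of the linear model grows in one perturbed gradient step. -/
theorem IsSmoothBelow.le_lintegral_linModel_sq (h : IsSmoothBelow g g' H L ρ gs)
    (hμ : IsNoise μ M2 M4 s2) (hL : 0 < L) (hρ : 0 ≤ ρ) (hα : 0 < α) {x0 e : E} {γ η : ℝ}
    (he : ‖e‖ = 1) (hHe : H x0 e = -η • e) (hγ : 0 < γ) (hγη : γ ≤ η) (hs2 : 0 ≤ s2) (x : E) :
    ENNReal.ofReal (linModel g' x0 e η x ^ 2) + ENNReal.ofReal (α ^ 2 * γ ^ 2 * s2)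
      ≤ ∫⁻ n, ENNReal.ofReal (linModel g' x0 e η (step α g' x n) ^ 2) ∂μ
        + ENNReal.ofReal (α * L * ρ ^ 2 / 2) * ENNReal.ofReal (‖x - x0‖ ^ 4) := by
  have := hμ.isProbabilityMeasure
  set b := linModel g' x0 e η x with hb
  set a : ℝ := inner ℝ e (g' x) with ha
  have hη : 0 < η := hγ.trans_le hγη
  have hηL : η ≤ L := by
    have h1 := (H x0).le_of_opNorm_le (h.norm_hessian_le hL.le x0) e
    rwa [hHe, norm_smul, he, mul_one, mul_one, norm_neg, Real.norm_eq_abs, abs_of_pos hη] at h1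
  -- The model is affine, so a step changes it by exactly `α η (a + ⟨e, n⟩)`; the noise term is
  -- centred and contributes `(α η)² s2` to the second moment.
  have hstep : ∀ n, linModel g' x0 e η (step α g' x n) ^ 2
      = (b + α * η * a) ^ 2 + inner ℝ ((2 * (b + α * η * a) * (α * η)) • e) n
        + (α * η) ^ 2 * (inner ℝ e n) ^ 2 := by
    intro n
    simp only [hb, ha, linModel, step, inner_sub_right, inner_smul_left, inner_smul_right,
      inner_add_right, conj_trivial]
    ring
  have herr := h.abs_inner_gradient_sub_linModel_le hρ he hHe x
  rw [← hb, ← ha] at herr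
  have herr2 : (a - b) ^ 2 ≤ ρ ^ 2 * ‖x - x0‖ ^ 4 := by
    have h1 := pow_le_pow_left₀ (abs_nonneg _) herr 2
    rw [sq_abs] at h1
    linarith
  have hi1 : Integrable (fun n => (b + α * η * a) ^ 2
      + inner ℝ ((2 * (b + α * η * a) * (α * η)) • e) n) μ :=
    (integrable_const _).add (hμ.integrable_inner _)
  have hi2 : Integrable (fun n => (α * η) ^ 2 * (inner ℝ e n) ^ 2) μ :=
    (hμ.integrable_inner_sq e).const_mul _
  have hint : ∫ n, linModel g' x0 e η (step α g' x n) ^ 2 ∂μ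
      = (b + α * η * a) ^ 2 + (α * η) ^ 2 * s2 := by
    simp only [hstep]
    rw [integral_add hi1 hi2, integral_add (integrable_const _) (hμ.integrable_inner _), hμ.mean,
      integral_const_mul, hμ.direction e he]
    simp
  have hint0 : Integrable (fun n => linModel g' x0 e η (step α g' x n) ^ 2) μ := by
    simp only [hstep]; exact hi1.add hi2
  rw [← ofReal_integral_eq_lintegral_ofReal hint0 (Eventually.of_forall fun n => sq_nonneg _), hint,
    ← ENNReal.ofReal_mul (by positivity), ← ENNReal.ofReal_add (by positivity) (by positivity),
    ← ENNReal.ofReal_add (by positivity) (by positivity)]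
  refine ENNReal.ofReal_le_ofReal ?_
  -- From `2ab = ((a + b)² - (a - b)²) / 2`: up to the linearization error the drift does not shrink
  -- the model.
  have h1 : b ^ 2 - α * η * (a - b) ^ 2 / 2 ≤ (b + α * η * a) ^ 2 := by
    have h3 : 0 ≤ α * η * (2 * b + (a - b)) ^ 2 := by positivity
    nlinarith [sq_nonneg (α * η * a)]
  have h2 : α * η * (a - b) ^ 2 ≤ α * L * (ρ ^ 2 * ‖x - x0‖ ^ 4) := by gcongr
  have h3 : α ^ 2 * γ ^ 2 * s2 ≤ (α * η) ^ 2 * s2 := by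
    rw [mul_pow]; gcongr
  linarith

/-- Jensen for `x ↦ x⁴` with weights proportional to `1 + αL` and `α`. Convexity again bounds the
total weight `w = (1 - α) · 1 + α (L + 2)` by `w⁴ ≤ 1 + (L + 2)⁴ α`, which keeps the growth factor
at `1 + O(α)`. -/
theorem add_pow_four_le {α L r c : ℝ} (hα : 0 < α) (hα1 : α ≤ 1) (hL : 0 < L) (hr : 0 ≤ r)
    (hc : 0 ≤ c) : ((1 + α * L) * r + α * c) ^ 4
      ≤ (1 + (L + 2) ^ 4 * α) * r ^ 4 + (L + 2) ^ 4 * α * c ^ 4 := by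
  set w := 1 + α * (L + 1) with hw
  have hw0 : 0 < w := by positivity
  have hw2 : w ≤ L + 2 := by nlinarith
  have h1 := (convexOn_pow 4).2 (Set.mem_Ici.2 hr) (Set.mem_Ici.2 hc)
    (show 0 ≤ (1 + α * L) / w by positivity) (show 0 ≤ α / w by positivity)
    (by rw [hw] at hw0 ⊢; field_simp; ring)
  simp only [smul_eq_mul] at h1
  have h2 : (1 + α * L) / w * r + α / w * c = ((1 + α * L) * r + α * c) / w := by ring
  rw [h2, div_pow, div_le_iff₀ (by positivity)] at h1
  have h3 : ((1 + α * L) / w * r ^ 4 + α / w * c ^ 4) * w ^ 4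
      = w ^ 3 * (1 + α * L) * r ^ 4 + w ^ 3 * α * c ^ 4 := by field_simp
  rw [h3] at h1
  have hw3 : w ^ 3 ≤ (L + 2) ^ 4 := by
    calc w ^ 3 ≤ (L + 2) ^ 3 := by gcongr
      _ ≤ (L + 2) ^ 4 := pow_le_pow_right₀ (by linarith) (by norm_num)
  have hw4 : w ^ 3 * (1 + α * L) ≤ 1 + (L + 2) ^ 4 * α := by
    have h5 : w ^ 3 * (1 + α * L) ≤ w ^ 4 := by
      have : 1 + α * L ≤ w := by rw [hw]; linarith
      calc w ^ 3 * (1 + α * L) ≤ w ^ 3 * w := by gcongr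
        _ = w ^ 4 := by ring
    have h6 := (convexOn_pow 4).2 (Set.mem_Ici.2 (zero_le_one' ℝ))
      (Set.mem_Ici.2 (show 0 ≤ L + 2 by linarith)) (show 0 ≤ 1 - α by linarith) hα.le (by ring)
    simp only [smul_eq_mul] at h6
    have h7 : (1 - α) * 1 + α * (L + 2) = w := by rw [hw]; ring
    rw [h7] at h6
    linarith
  calc _ ≤ _ := h1
    _ ≤ _ := by gcongr

omit [BorelSpace E] [SecondCountableTopology E] in
/-- Growth of the fourth moment of the distance to a nearly stationary point. -/
theorem IsSmoothBelow.lintegral_norm_four_le (h : IsSmoothBelow g g' H L ρ gs)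
    (hμ : IsNoise μ M2 M4 s2) (hL : 0 < L) (hα : 0 < α) (hα1 : α ≤ 1) {x0 : E} {C : ℝ}
    (hx0 : ‖g' x0‖ ^ 4 ≤ C * α ^ 2) (x : E) :
    ∫⁻ n, ENNReal.ofReal (‖step α g' x n - x0‖ ^ 4) ∂μ
      ≤ ENNReal.ofReal (1 + (1 + 2 * (L + 2) ^ 4) * α) * ENNReal.ofReal (‖x - x0‖ ^ 4)
        + ENNReal.ofReal ((2 * (L + 2) ^ 4 * C + 16 * M2 ^ 2 + 3 * M4) * α ^ 3) := by
  have := hμ.isProbabilityMeasure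
  have hM2 := hμ.second_nonneg
  have hM4 := hμ.fourth_nonneg
  have hC : 0 ≤ C := nonneg_of_mul_nonneg_left ((by positivity : (0:ℝ) ≤ _).trans hx0)
    (by positivity)
  set u := x - x0 - α • g' x with hu
  -- Majorant of `‖u - α n‖⁴`: the linear term is kept because its mean vanishes, while the cubic
  -- term is absorbed through `-4bc ≤ 2b² + 2c²` with `b = α ⟨u, n⟩`, `c = α² ‖n‖²`.
  set k : E → ℝ := fun n => ‖u‖ ^ 4 + inner ℝ ((-4 * α * ‖u‖ ^ 2) • u) n
    + 8 * α ^ 2 * ‖u‖ ^ 2 * ‖n‖ ^ 2 + 3 * α ^ 4 * ‖n‖ ^ 4 with hk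
  have hle : ∀ n, ‖step α g' x n - x0‖ ^ 4 ≤ k n := by
    intro n
    have h1 : step α g' x n - x0 = u - α • n := by
      simp only [step, hu, smul_add]; abel
    have h2 : ‖u - α • n‖ ^ 2 = ‖u‖ ^ 2 - 2 * α * inner ℝ u n + α ^ 2 * ‖n‖ ^ 2 := by
      rw [norm_sub_sq_real, inner_smul_right, norm_smul, mul_pow, Real.norm_eq_abs, sq_abs]
      ring
    have h3 : (inner ℝ u n) ^ 2 ≤ ‖u‖ ^ 2 * ‖n‖ ^ 2 := by
      rw [← mul_pow]
      exact sq_le_sq' (abs_le.1 (abs_real_inner_le_norm u n)).1 (real_inner_le_norm u n)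
    have h4 : ‖step α g' x n - x0‖ ^ 4
        = (‖u‖ ^ 2 - 2 * α * inner ℝ u n + α ^ 2 * ‖n‖ ^ 2) ^ 2 := by
      rw [h1, ← h2]; ring
    rw [h4]
    simp only [hk, inner_smul_left, conj_trivial]
    have h5 : α ^ 2 * (inner ℝ u n) ^ 2 ≤ α ^ 2 * (‖u‖ ^ 2 * ‖n‖ ^ 2) := by gcongr
    nlinarith [sq_nonneg (α * inner ℝ u n + α ^ 2 * ‖n‖ ^ 2)]
  have hk0 : 0 ≤ k := fun n => (by positivity : (0 : ℝ) ≤ _).trans (hle n)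
  have hi1 : Integrable (fun n => ‖u‖ ^ 4 + inner ℝ ((-4 * α * ‖u‖ ^ 2) • u) n) μ :=
    (integrable_const _).add (hμ.integrable_inner _)
  have hi2 : Integrable (fun n : E => 8 * α ^ 2 * ‖u‖ ^ 2 * ‖n‖ ^ 2) μ :=
    hμ.integrable_norm_sq.const_mul _
  have hi12 : Integrable (fun n => ‖u‖ ^ 4 + inner ℝ ((-4 * α * ‖u‖ ^ 2) • u) n
      + 8 * α ^ 2 * ‖u‖ ^ 2 * ‖n‖ ^ 2) μ := hi1.add hi2
  have hi3 : Integrable (fun n : E => 3 * α ^ 4 * ‖n‖ ^ 4) μ :=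
    hμ.integrable_norm_four.const_mul _
  have hint : ∫ n, k n ∂μ = ‖u‖ ^ 4 + 8 * α ^ 2 * ‖u‖ ^ 2 * M2 + 3 * α ^ 4 * M4 := by
    simp only [hk]
    rw [integral_add hi12 hi3, integral_add hi1 hi2,
      integral_add (integrable_const _) (hμ.integrable_inner _), hμ.mean, integral_const_mul,
      integral_const_mul, hμ.second, hμ.fourth]
    simp
  refine (lintegral_ofReal_le_of_le (hi12.add hi3) hk0 hle).trans ?_
  change ENNReal.ofReal (∫ n, k n ∂μ) ≤ _
  rw [hint, ← ENNReal.ofReal_mul (by positivity),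
    ← ENNReal.ofReal_add (by positivity) (by positivity)]
  refine ENNReal.ofReal_le_ofReal ?_
  have hun : ‖u‖ ≤ (1 + α * L) * ‖x - x0‖ + α * ‖g' x0‖ := by
    have h1 := h.gradient_lip x x0
    have h2 : ‖g' x‖ ≤ ‖g' x - g' x0‖ + ‖g' x0‖ := by
      simpa using norm_add_le (g' x - g' x0) (g' x0)
    have h3 : ‖u‖ ≤ ‖x - x0‖ + α * ‖g' x‖ := by
      refine (norm_sub_le _ _).trans ?_
      rw [norm_smul, Real.norm_eq_abs, abs_of_pos hα]
    nlinarith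
  set D := (L + 2) ^ 4 with hD
  have hD1 : 0 ≤ D := by positivity
  have hu4 : ‖u‖ ^ 4 ≤ (1 + D * α) * ‖x - x0‖ ^ 4 + D * α * (C * α ^ 2) := by
    calc ‖u‖ ^ 4 ≤ ((1 + α * L) * ‖x - x0‖ + α * ‖g' x0‖) ^ 4 := by gcongr
      _ ≤ (1 + D * α) * ‖x - x0‖ ^ 4 + D * α * ‖g' x0‖ ^ 4 :=
        add_pow_four_le hα hα1 hL (norm_nonneg _) (norm_nonneg _)
      _ ≤ _ := by gcongr
  -- Young's inequality, balanced so that the growth factor stays `1 + O(α)` and the source term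
  -- `O(α³)`.
  have h1 : 8 * α ^ 2 * ‖u‖ ^ 2 * M2 ≤ α * ‖u‖ ^ 4 + 16 * M2 ^ 2 * α ^ 3 := by
    have : 0 ≤ α * (‖u‖ ^ 2 - 4 * α * M2) ^ 2 := by positivity
    nlinarith
  have h2 : 3 * α ^ 4 * M4 ≤ 3 * M4 * α ^ 3 := by
    have : α ^ 4 ≤ α ^ 3 := pow_le_pow_of_le_one hα.le hα1 (by norm_num)
    nlinarith
  have h3 : (1 + α) * ‖u‖ ^ 4 ≤ (1 + α) * ((1 + D * α) * ‖x - x0‖ ^ 4 + D * α * (C * α ^ 2)) := by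
    gcongr
  have h4 : (1 + α) * (1 + D * α) * ‖x - x0‖ ^ 4 ≤ (1 + (1 + 2 * D) * α) * ‖x - x0‖ ^ 4 := by
    gcongr
    have : D * α * α ≤ D * α * 1 := by gcongr
    linarith
  have h5 : (1 + α) * (D * α * (C * α ^ 2)) ≤ 2 * (D * α * (C * α ^ 2)) := by
    gcongr; linarith
  linarith

end Noise

/-! ### Markov operators, survival probabilities and drift -/

section MarkovOperator

variable {E : Type*} [MeasurableSpace E]

/-- The algebraic properties of the transition operator of a Markov chain, acting on functions with
values in `[0, ∞]`. -/
structure IsMarkovOperator (Q : (E → ℝ≥0∞) → E → ℝ≥0∞) : Prop where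
  measurable : ∀ {h}, Measurable h → Measurable (Q h)
  mono : ∀ {h k}, h ≤ k → Q h ≤ Q k
  add : ∀ {h} k, Measurable h → Q (h + k) = Q h + Q k
  const_mul : ∀ c h, c ≠ ∞ → Q (fun x => c * h x) = fun x => c * Q h x
  const : ∀ c, Q (fun _ => c) = fun _ => c

namespace IsMarkovOperator

variable {Q : (E → ℝ≥0∞) → E → ℝ≥0∞}

theorem iterate (hQ : IsMarkovOperator Q) (k : ℕ) : IsMarkovOperator Q^[k] := by
  induction k with
  | zero => exact ⟨fun h => h, fun h => h, fun _ _ => rfl, fun _ _ _ => rfl, fun _ => rfl⟩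
  | succ k ih =>
    simp only [Function.iterate_succ']
    refine ⟨fun h => hQ.measurable (ih.measurable h), fun h => hQ.mono (ih.mono h),
      fun {h} k' hh => ?_, fun c h hc => ?_, fun c => ?_⟩
    · simp only [Function.comp, ih.add k' hh, hQ.add _ (ih.measurable hh)]
    · simp only [Function.comp, ih.const_mul c h hc, hQ.const_mul c _ hc]
    · simp only [Function.comp, ih.const, hQ.const]

theorem sum (hQ : IsMarkovOperator Q) {u : ℕ → E → ℝ≥0∞} (hu : ∀ i, Measurable (u i)) (j : ℕ) :
    Q (fun x => ∑ i ∈ Finset.range j, u i x) = fun x => ∑ i ∈ Finset.range j, Q (u i) x := by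
  induction j with
  | zero => simpa using hQ.const 0
  | succ j ih =>
    simp only [Finset.sum_range_succ]
    have h1 : Measurable fun x => ∑ i ∈ Finset.range j, u i x :=
      Finset.measurable_sum _ fun i _ => hu i
    have h2 := hQ.add (u j) h1
    rw [ih] at h2
    exact h2

end IsMarkovOperator

/-- The probability that a Markov chain stays in `bad` at the times `0, …, j - 1`. -/
noncomputable def survival (Q : (E → ℝ≥0∞) → E → ℝ≥0∞) (bad : Set E) : ℕ → E → ℝ≥0∞
  | 0 => fun _ => 1
  | j + 1 => bad.indicator (Q (survival Q bad j))

variable {Q : (E → ℝ≥0∞) → E → ℝ≥0∞} {bad : Set E}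

theorem measurable_survival (hQ : IsMarkovOperator Q) (hbad : MeasurableSet bad) (j : ℕ) :
    Measurable (survival Q bad j) := by
  induction j with
  | zero => exact measurable_const
  | succ j ih => exact (hQ.measurable ih).indicator hbad

theorem survival_succ_le (hQ : IsMarkovOperator Q) (j : ℕ) :
    survival Q bad (j + 1) ≤ survival Q bad j := by
  induction j with
  | zero =>
    refine (Set.indicator_le_self _ _).trans ?_
    simp only [survival, hQ.const, le_refl]
  | succ j ih => exact Set.indicator_mono (hQ.mono ih)

theorem survival_antitone (hQ : IsMarkovOperator Q) : Antitone (survival Q bad) :=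
  antitone_nat_of_succ_le (survival_succ_le hQ)

theorem survival_add_le (hQ : IsMarkovOperator Q) (i j : ℕ) :
    survival Q bad (i + j) ≤ Q^[i] (survival Q bad j) := by
  induction i with
  | zero => simp
  | succ i ih =>
    rw [Function.iterate_succ_apply', add_right_comm]
    exact (Set.indicator_le_self _ _).trans (hQ.mono ih)

/-- A drift condition over random numbers of steps at most `T` bounds the expected time spent
before leaving `bad`. -/
theorem mul_sum_survival_le (hQ : IsMarkovOperator Q) (hbad : MeasurableSet bad) {V : E → ℝ≥0∞}
    (hV : Measurable V) {q : ℝ≥0∞} (hq : q ≠ ∞) {T : ℕ}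
    (hdrift : ∀ x ∈ bad, ∃ i, 0 < i ∧ i ≤ T ∧ Q^[i] V x + q * i ≤ V x) (j : ℕ) (x : E) :
    q * ∑ l ∈ Finset.range j, survival Q bad (l + 1) x ≤ V x + q * T := by
  have hle1 : ∀ l x, survival Q bad l x ≤ 1 := fun l x => survival_antitone hQ (Nat.zero_le l) x
  have hsum : ∀ j x, ∑ l ∈ Finset.range j, survival Q bad (l + 1) x ≤ j := fun j x => by
    simpa using Finset.sum_le_card_nsmul (Finset.range j) _ 1 fun l _ => hle1 (l + 1) x
  -- Strong induction on the horizon: from a bad point jump ahead by its own drift time `i`. Each of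
  -- the `i` skipped terms is at most 1 and is paid for by the drift; a horizon shorter than `i`
  -- costs at most `q T`.
  induction j using Nat.strong_induction_on generalizing x with
  | _ j ih =>
    by_cases hx : x ∈ bad
    swap
    · simp [survival, hx]
    obtain ⟨i, hi0, hiT, hi⟩ := hdrift x hx
    rcases le_total j i with hji | hij
    · calc q * ∑ l ∈ Finset.range j, survival Q bad (l + 1) x ≤ q * j := by gcongr; exact hsum j x
        _ ≤ q * T := by gcongr; exact hji.trans hiT
        _ ≤ _ := le_add_self
    · obtain ⟨k, rfl⟩ := Nat.exists_eq_add_of_le hij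
      rw [Finset.sum_range_add, mul_add]
      have h1 : q * ∑ l ∈ Finset.range k, survival Q bad (i + l + 1) x ≤ Q^[i] V x + q * T := by
        calc q * ∑ l ∈ Finset.range k, survival Q bad (i + l + 1) x
            ≤ q * ∑ l ∈ Finset.range k, Q^[i] (survival Q bad (l + 1)) x := by
              gcongr with l
              exact survival_add_le hQ i (l + 1) x
          _ = Q^[i] (fun y => q * ∑ l ∈ Finset.range k, survival Q bad (l + 1) y) x := by
              rw [(hQ.iterate i).const_mul _ _ hq,
                (hQ.iterate i).sum fun l => measurable_survival hQ hbad (l + 1)]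
          _ ≤ Q^[i] (V + fun _ => q * T) x := (hQ.iterate i).mono (fun y => ih k (by omega) y) x
          _ = Q^[i] V x + q * T := by
              rw [(hQ.iterate i).add _ hV, (hQ.iterate i).const]; rfl
      calc _ ≤ q * i + (Q^[i] V x + q * T) := by gcongr; exact hsum i x
        _ = Q^[i] V x + q * i + q * T := by ring
        _ ≤ _ := by gcongr

/-- Survival decreases in time, so `j` times its last value is at most the bounded sum. -/
theorem mul_survival_le (hQ : IsMarkovOperator Q) (hbad : MeasurableSet bad) {V : E → ℝ≥0∞}
    (hV : Measurable V) {q : ℝ≥0∞} (hq : q ≠ ∞) {T : ℕ}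
    (hdrift : ∀ x ∈ bad, ∃ i, 0 < i ∧ i ≤ T ∧ Q^[i] V x + q * i ≤ V x) (j : ℕ) (x : E) :
    q * j * survival Q bad j x ≤ V x + q * T := by
  refine le_trans ?_ (mul_sum_survival_le hQ hbad hV hq hdrift j x)
  rw [mul_assoc]
  gcongr
  simpa using Finset.card_nsmul_le_sum (Finset.range j) (fun l => survival Q bad (l + 1) x)
    (survival Q bad j x) fun l hl => survival_antitone hQ (Finset.mem_range.1 hl) x

end MarkovOperator

/-! ### The transition operator of perturbed gradient descent -/

section Transition

variable {E : Type*} [NormedAddCommGroup E] [InnerProductSpace ℝ E]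
  [MeasurableSpace E] [BorelSpace E] [SecondCountableTopology E]

/-- The transition operator of perturbed gradient descent. -/
noncomputable def transition (μ : Measure E) (α : ℝ) (g' : E → E) (h : E → ℝ≥0∞) (x : E) : ℝ≥0∞ :=
  ∫⁻ n, h (step α g' x n) ∂μ

theorem measurable_step {α : ℝ} {g' : E → E} (hg' : Measurable g') :
    Measurable fun z : E × E => step α g' z.1 z.2 := by
  unfold step
  fun_prop

theorem isMarkovOperator_transition (μ : Measure E) [IsProbabilityMeasure μ] (α : ℝ) {g' : E → E}
    (hg' : Measurable g') : IsMarkovOperator (transition μ α g') where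
  measurable hh := (hh.comp (measurable_step hg')).lintegral_prod_right'
  mono hhk x := lintegral_mono fun n => hhk _
  add {h} k hh := funext fun x => lintegral_add_left
    (hh.comp ((measurable_step hg').comp measurable_prodMk_left)) _
  const_mul c h hc := funext fun x => lintegral_const_mul' c _ hc
  const c := funext fun x => by simp [transition]

end Transition

/-! ### Deterministic recursions for the escape argument -/

section Recursion

/-- A discrete Grönwall inequality; over `O(1/α)` steps the source `d α³` accumulates only to
`O(α²)`. -/
theorem iterate_le_of_le {R : ℕ → ℝ≥0∞} {c d α : ℝ} (hc : 0 ≤ c) (hd : 0 ≤ d) (hα : 0 < α)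
    (h0 : R 0 = 0)
    (hR : ∀ k, R (k + 1) ≤ ENNReal.ofReal (1 + c * α) * R k + ENNReal.ofReal (d * α ^ 3)) (k : ℕ) :
    R k ≤ ENNReal.ofReal (d * α ^ 3 * k * (1 + c * α) ^ k) := by
  induction k with
  | zero => simp [h0]
  | succ k ih =>
    refine (hR k).trans ?_
    refine (add_le_add_left (mul_le_mul_right ih _) _).trans ?_
    rw [← ENNReal.ofReal_mul (by positivity), ← ENNReal.ofReal_add (by positivity) (by positivity)]
    refine ENNReal.ofReal_le_ofReal ?_
    have h1 : (1 : ℝ) ≤ (1 + c * α) ^ (k + 1) := one_le_pow₀ (by nlinarith)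
    have h2 : d * α ^ 3 * 1 ≤ d * α ^ 3 * (1 + c * α) ^ (k + 1) := by gcongr
    have h3 : d * α ^ 3 * (k + 1 : ℕ) * (1 + c * α) ^ (k + 1)
        = (1 + c * α) * (d * α ^ 3 * k * (1 + c * α) ^ k) + d * α ^ 3 * (1 + c * α) ^ (k + 1) := by
      push_cast; ring
    rw [h3]
    linarith

/-- The expected objective `A` decreases over a fixed time horizon if the second moment `B` of the
gradient grows and the fourth moment `R` of the displacement is controlled. -/
theorem add_le_of_recursions {A B R : ℕ → ℝ≥0∞} {α c d l l' β D q t K : ℝ} (hα : 0 < α)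
    (hα1 : α ≤ 1) (hc : 0 ≤ c) (hd : 0 ≤ d) (hl : 0 ≤ l) (hl' : 0 ≤ l') (hβ : 0 < β) (hD : 0 ≤ D)
    (hq : 0 ≤ q) (ht : t = 16 * (D + 1 + q) / β)
    (hK : K = d * (t + 2) * Real.exp (c * (t + 2)))
    (hα2 : l * K * α ≤ β / 2) (hα3 : l' * K * α ≤ 1) (hR0 : R 0 = 0)
    (hR : ∀ k, R (k + 1) ≤ ENNReal.ofReal (1 + c * α) * R k + ENNReal.ofReal (d * α ^ 3))
    (hB : ∀ k, B k + ENNReal.ofReal (α ^ 2 * β) ≤ B (k + 1) + ENNReal.ofReal (α * l) * R k)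
    (hA : ∀ k, A (k + 1) + ENNReal.ofReal (α / 4) * B k
      ≤ A k + ENNReal.ofReal (α * l') * R k + ENNReal.ofReal (α ^ 2 * D))
    {T : ℕ} (hT : T = ⌈t / α⌉₊ + 1) :
    A T + ENNReal.ofReal (q * α ^ 2) * T ≤ A 0 := by
  have ht0 : 0 ≤ t := by rw [ht]; positivity
  have hT1 : t ≤ (T - 1) * α := by
    rw [hT]; push_cast
    rw [add_sub_cancel_right, ← div_le_iff₀ hα]
    exact Nat.le_ceil _
  have hT2 : T * α ≤ t + 2 := by
    rw [hT]; push_cast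
    have := Nat.ceil_lt_add_one (div_nonneg ht0 hα.le)
    have h2 : t / α * α = t := by field_simp
    nlinarith
  have hK0 : 0 ≤ K := by rw [hK]; positivity
  have hRk : ∀ k ≤ T, R k ≤ ENNReal.ofReal (K * α ^ 2) := by
    intro k hk
    refine (iterate_le_of_le hc hd hα hR0 hR k).trans (ENNReal.ofReal_le_ofReal ?_)
    have hkT : k * α ≤ t + 2 := by
      have : (k : ℝ) ≤ T := by exact_mod_cast hk
      nlinarith
    have h1 : (1 + c * α) ^ k ≤ Real.exp (c * (t + 2)) := by
      calc (1 + c * α) ^ k ≤ Real.exp (c * α) ^ k := by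
            gcongr; rw [add_comm]; exact Real.add_one_le_exp _
        _ = Real.exp (c * (k * α)) := by rw [← Real.exp_nat_mul]; ring_nf
        _ ≤ _ := by gcongr
    calc d * α ^ 3 * k * (1 + c * α) ^ k = d * (k * α) * (1 + c * α) ^ k * α ^ 2 := by ring
      _ ≤ d * (t + 2) * Real.exp (c * (t + 2)) * α ^ 2 := by gcongr
      _ = _ := by rw [hK]
  -- The error term takes at most half of the gain `α² β`, leaving linear growth.
  have hBk : ∀ k ≤ T, ENNReal.ofReal (k * (α ^ 2 * β / 2)) ≤ B k := by
    intro k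
    induction k with
    | zero => simp
    | succ k ih =>
      intro hk
      have h1 : ENNReal.ofReal (α * l) * R k ≤ ENNReal.ofReal (α ^ 2 * β / 2) := by
        refine (mul_le_mul_right (hRk k (by omega)) _).trans ?_
        rw [← ENNReal.ofReal_mul (by positivity)]
        refine ENNReal.ofReal_le_ofReal ?_
        have := mul_le_mul_of_nonneg_left hα2 (sq_nonneg α)
        linarith
      have h2 := (hB k).trans (add_le_add_right h1 _)
      have h3 : ENNReal.ofReal (α ^ 2 * β)
          = ENNReal.ofReal (α ^ 2 * β / 2) + ENNReal.ofReal (α ^ 2 * β / 2) := by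
        rw [← ENNReal.ofReal_add (by positivity) (by positivity), add_halves]
      rw [h3, ← add_assoc] at h2
      have h4 := (ENNReal.add_le_add_iff_right ENNReal.ofReal_ne_top).1 h2
      refine le_trans ?_ h4
      push_cast
      rw [add_mul, one_mul, ENNReal.ofReal_add (by positivity) (by positivity)]
      gcongr
      exact ih (by omega)
  -- Summing the linear lower bound on `B` gives a quadratic gain against a linear cost; the `1` in
  -- `D + 1` pays for the fourth-moment error.
  have hAk : ∀ k ≤ T, A k + ENNReal.ofReal (k * (k - 1) / 2 * (α ^ 3 * β / 8))
      ≤ A 0 + ENNReal.ofReal (k * (α ^ 2 * (D + 1))) := by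
    intro k
    induction k with
    | zero => simp
    | succ k ih =>
      intro hk
      have h1 : ENNReal.ofReal (α * l') * R k ≤ ENNReal.ofReal (α ^ 2 * 1) := by
        refine (mul_le_mul_right (hRk k (by omega)) _).trans ?_
        rw [← ENNReal.ofReal_mul (by positivity)]
        refine ENNReal.ofReal_le_ofReal ?_
        have := mul_le_mul_of_nonneg_left hα3 (sq_nonneg α)
        linarith
      have h2 : A (k + 1) + ENNReal.ofReal (k * (α ^ 3 * β / 8))
          ≤ A k + ENNReal.ofReal (α ^ 2 * (D + 1)) := by
        calc _ ≤ A (k + 1) + ENNReal.ofReal (α / 4) * B k := by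
              gcongr
              refine le_trans ?_ (mul_le_mul_right (hBk k (by omega)) _)
              rw [← ENNReal.ofReal_mul (by positivity)]
              exact ENNReal.ofReal_le_ofReal (le_of_eq (by ring))
          _ ≤ _ := hA k
          _ ≤ A k + ENNReal.ofReal (α ^ 2 * 1) + ENNReal.ofReal (α ^ 2 * D) := by gcongr
          _ = _ := by
              rw [add_assoc, ← ENNReal.ofReal_add (by positivity) (by positivity)]
              ring_nf
      have hk1 : (0 : ℝ) ≤ k * (k - 1) := by
        rcases Nat.eq_zero_or_pos k with rfl | hk0
        · simp
        · have : (1 : ℝ) ≤ k := by exact_mod_cast hk0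
          nlinarith
      have e1 : ((k + 1 : ℕ) : ℝ) * ((k + 1 : ℕ) - 1) / 2 * (α ^ 3 * β / 8)
          = k * (k - 1) / 2 * (α ^ 3 * β / 8) + k * (α ^ 3 * β / 8) := by push_cast; ring
      have e2 : ((k + 1 : ℕ) : ℝ) * (α ^ 2 * (D + 1))
          = k * (α ^ 2 * (D + 1)) + α ^ 2 * (D + 1) := by push_cast; ring
      rw [e1, e2, ENNReal.ofReal_add (by positivity) (by positivity),
        ENNReal.ofReal_add (by positivity) (by positivity)]
      calc _ = (A (k + 1) + ENNReal.ofReal (k * (α ^ 3 * β / 8)))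
            + ENNReal.ofReal (k * (k - 1) / 2 * (α ^ 3 * β / 8)) := by ring
        _ ≤ (A k + ENNReal.ofReal (α ^ 2 * (D + 1)))
            + ENNReal.ofReal (k * (k - 1) / 2 * (α ^ 3 * β / 8)) := by gcongr
        _ = (A k + ENNReal.ofReal (k * (k - 1) / 2 * (α ^ 3 * β / 8)))
            + ENNReal.ofReal (α ^ 2 * (D + 1)) := by ring
        _ ≤ (A 0 + ENNReal.ofReal (k * (α ^ 2 * (D + 1))))
            + ENNReal.ofReal (α ^ 2 * (D + 1)) :=
              add_le_add_left (ih (by omega)) _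
        _ = _ := by ring
  have hfin := hAk T le_rfl
  -- After division by `T α²` this is `16 (D + 1 + q) ≤ (T - 1) α β`, which dictates `t`; the `+ 1`
  -- in `T` makes `T - 1` at least `t / α`.
  have hlow : T * (α ^ 2 * (D + 1)) + q * α ^ 2 * T ≤ T * (T - 1) / 2 * (α ^ 3 * β / 8) := by
    have h1 : 16 * (D + 1 + q) ≤ (T - 1) * α * β := by
      rw [ht, div_le_iff₀ hβ] at hT1; exact hT1
    have h2 := mul_le_mul_of_nonneg_left h1 (show 0 ≤ (T : ℝ) * α ^ 2 / 16 by positivity)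
    linarith
  have h5 := (add_le_add_right (ENNReal.ofReal_le_ofReal hlow) (A T)).trans hfin
  rw [add_comm ((T : ℝ) * _), ENNReal.ofReal_add (by positivity) (by positivity), ← add_assoc] at h5
  have h6 := (ENNReal.add_le_add_iff_right ENNReal.ofReal_ne_top).1 h5
  rwa [ENNReal.ofReal_mul (by positivity), ENNReal.ofReal_natCast] at h6

end Recursion

/-! ### Saddle escape and the high-probability bound -/

section Abstract

variable {E : Type*} [NormedAddCommGroup E] [InnerProductSpace ℝ E] [FiniteDimensional ℝ E]
  [MeasurableSpace E] [BorelSpace E]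
  {μ : Measure E} {M2 M4 s2 : ℝ} {g : E → ℝ} {g' : E → E} {H : E → E →L[ℝ] E} {L ρ gs α : ℝ}

/-- Escape from a nearly stationary point with a direction of negative curvature: the expected
objective decreases over `O(1 / α)` steps at any prescribed rate `q * α ^ 2` per step. -/
theorem IsSmoothBelow.saddle_drift (h : IsSmoothBelow g g' H L ρ gs)
    (hμ : IsNoise μ M2 M4 s2) (hs2 : 0 < s2) (hL : 0 < L) (hρ : 0 ≤ ρ) (hα : 0 < α) (hα1 : α ≤ 1)
    (hαL : 4 * L * α ≤ 1) {γ C q t K : ℝ} (hγ : 0 < γ) (hC : 0 ≤ C) (hq : 0 ≤ q)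
    (ht : t = 16 * (L * M2 + 1 + q) / (γ ^ 2 * s2))
    (hK : K = (2 * (L + 2) ^ 4 * C + 16 * M2 ^ 2 + 3 * M4) * (t + 2)
      * Real.exp ((1 + 2 * (L + 2) ^ 4) * (t + 2)))
    (hα2 : L * ρ ^ 2 / 2 * K * α ≤ γ ^ 2 * s2 / 2) (hα3 : ρ ^ 2 / 2 * K * α ≤ 1)
    {x0 : E} (hx0 : ‖g' x0‖ ^ 4 ≤ C * α ^ 2) (hd : ∃ d, inner ℝ d (H x0 d) < -γ * ‖d‖ ^ 2) :
    (transition μ α g')^[⌈t / α⌉₊ + 1] (fun x => ENNReal.ofReal (g x - gs)) x0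
      + ENNReal.ofReal (q * α ^ 2) * (⌈t / α⌉₊ + 1 : ℕ) ≤ ENNReal.ofReal (g x0 - gs) := by
  have := hμ.isProbabilityMeasure
  have hM2 := hμ.second_nonneg
  have hM4 := hμ.fourth_nonneg
  have hg' := h.continuous_gradient
  have hQ := isMarkovOperator_transition μ α hg'.measurable
  set Q := transition μ α g' with hQdef
  obtain ⟨d, hd⟩ := hd
  obtain ⟨e, he, η, hγη, hHe⟩ := exists_unit_eigenvector_of_inner_lt (h.hessian_symm x0) hd
  set V : E → ℝ≥0∞ := fun x => ENNReal.ofReal (g x - gs) with hV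
  set b : E → ℝ≥0∞ := fun x => ENNReal.ofReal (linModel g' x0 e η x ^ 2) with hb
  set r : E → ℝ≥0∞ := fun x => ENNReal.ofReal (‖x - x0‖ ^ 4) with hr
  have hbm : Measurable b := by
    have : Continuous (linModel g' x0 e η) := by unfold linModel; fun_prop
    exact (this.pow 2).measurable.ennreal_ofReal
  have hrm : Measurable r := by
    have : Continuous fun x : E => ‖x - x0‖ ^ 4 := by fun_prop
    exact this.measurable.ennreal_ofReal
  have hVm : Measurable V := (h.continuous.sub continuous_const).measurable.ennreal_ofReal
  refine add_le_of_recursions (A := fun k => Q^[k] V x0) (B := fun k => Q^[k] b x0)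
    (R := fun k => Q^[k] r x0) (l := L * ρ ^ 2 / 2) (l' := ρ ^ 2 / 2) (β := γ ^ 2 * s2)
    (D := L * M2) hα hα1 (c := 1 + 2 * (L + 2) ^ 4)
    (d := 2 * (L + 2) ^ 4 * C + 16 * M2 ^ 2 + 3 * M4)
    (by positivity) (by positivity) (by positivity) (by positivity) (by positivity) (by positivity)
    hq ht hK hα2 hα3 ?_ ?_ ?_ ?_ rfl
  · simp [hr]
  · intro k
    have h1 : Q r ≤ (fun x => ENNReal.ofReal (1 + (1 + 2 * (L + 2) ^ 4) * α) * r x)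
        + fun _ => ENNReal.ofReal ((2 * (L + 2) ^ 4 * C + 16 * M2 ^ 2 + 3 * M4) * α ^ 3) :=
      fun x => h.lintegral_norm_four_le hμ hL hα hα1 hx0 x
    have h2 := (hQ.iterate k).mono h1 x0
    rw [(hQ.iterate k).add _ (hrm.const_mul _), (hQ.iterate k).const_mul _ _ ENNReal.ofReal_ne_top,
      (hQ.iterate k).const] at h2
    exact h2
  · intro k
    have h1 : b + (fun _ => ENNReal.ofReal (α ^ 2 * (γ ^ 2 * s2)))
        ≤ Q b + fun x => ENNReal.ofReal (α * (L * ρ ^ 2 / 2)) * r x := fun x => by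
      have := h.le_lintegral_linModel_sq hμ hL hρ hα he hHe hγ hγη hs2.le x
      rw [mul_assoc (α ^ 2), mul_assoc α, mul_div_assoc] at this
      exact this
    have h2 := (hQ.iterate k).mono h1 x0
    rw [(hQ.iterate k).add _ hbm, (hQ.iterate k).add _ (hQ.measurable hbm),
      (hQ.iterate k).const_mul _ _ ENNReal.ofReal_ne_top, (hQ.iterate k).const] at h2
    exact h2
  · intro k
    have h1 : Q V + (fun x => ENNReal.ofReal (α / 4) * b x)
        ≤ (V + fun x => ENNReal.ofReal (α * (ρ ^ 2 / 2)) * r x)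
          + fun _ => ENNReal.ofReal (α ^ 2 * (L * M2)) := fun x => by
      have h2 := h.lintegral_step_le hμ hL hα hαL x
      have h3 := h.abs_inner_gradient_sub_linModel_le hρ he hHe x
      -- The gradient norm dominates its component along `e`, which the linear model approximates:
      -- `b² ≤ 2 ‖g' x‖² + 2 (error)²`.
      have h4 : ENNReal.ofReal (α / 4) * b x
          ≤ ENNReal.ofReal (α / 2 * ‖g' x‖ ^ 2) + ENNReal.ofReal (α * (ρ ^ 2 / 2)) * r x := by
        rw [← ENNReal.ofReal_mul (by positivity), ← ENNReal.ofReal_mul (by positivity),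
          ← ENNReal.ofReal_add (by positivity) (by positivity)]
        refine ENNReal.ofReal_le_ofReal ?_
        have h5 := pow_le_pow_left₀ (abs_nonneg _) h3 2
        rw [sq_abs] at h5
        have h6 : (inner ℝ e (g' x)) ^ 2 ≤ ‖g' x‖ ^ 2 := by
          have := abs_real_inner_le_norm e (g' x)
          rw [he, one_mul] at this
          rw [← sq_abs]
          gcongr
        set a : ℝ := inner ℝ e (g' x)
        set b := linModel g' x0 e η x
        have h7 : b ^ 2 ≤ 2 * ‖g' x‖ ^ 2 + 2 * (ρ * ‖x - x0‖ ^ 2) ^ 2 := by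
          nlinarith [sq_nonneg (a + (a - b))]
        have h8 := mul_le_mul_of_nonneg_left h7 (show 0 ≤ α / 4 by positivity)
        linarith
      show Q V x + ENNReal.ofReal (α / 4) * b x
        ≤ V x + ENNReal.ofReal (α * (ρ ^ 2 / 2)) * r x + ENNReal.ofReal (α ^ 2 * (L * M2))
      have h9 : L * α ^ 2 * M2 = α ^ 2 * (L * M2) := by ring
      rw [h9] at h2
      calc _ ≤ Q V x + (ENNReal.ofReal (α / 2 * ‖g' x‖ ^ 2)
            + ENNReal.ofReal (α * (ρ ^ 2 / 2)) * r x) := by gcongr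
        _ = (Q V x + ENNReal.ofReal (α / 2 * ‖g' x‖ ^ 2))
            + ENNReal.ofReal (α * (ρ ^ 2 / 2)) * r x := by rw [add_assoc]
        _ ≤ (V x + ENNReal.ofReal (α ^ 2 * (L * M2)))
            + ENNReal.ofReal (α * (ρ ^ 2 / 2)) * r x := add_le_add_left h2 _
        _ = _ := by ring
    have h2 := (hQ.iterate k).mono h1 x0
    rw [(hQ.iterate k).add _ (hQ.measurable hVm),
      (hQ.iterate k).add _ (hVm.add (hrm.const_mul _)), (hQ.iterate k).add _ hVm,
      (hQ.iterate k).const_mul _ _ ENNReal.ofReal_ne_top,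
      (hQ.iterate k).const_mul _ _ ENNReal.ofReal_ne_top, (hQ.iterate k).const] at h2
    exact h2

theorem eventually_mul_le (a : ℝ) {b : ℝ} (hb : 0 < b) : ∀ᶠ α in nhdsWithin (0 : ℝ) (Set.Ioi 0),
    a * α ≤ b := by
  have h : Tendsto (fun α : ℝ => a * α) (nhds 0) (nhds (a * 0)) :=
    (continuous_const.mul continuous_id).tendsto 0
  rw [mul_zero] at h
  exact (h.eventually_le_const hb).filter_mono nhdsWithin_le_nhds

/-- For small step sizes `α`, perturbed gradient descent reaches the set `good`, outside of which
the gradient is large or the Hessian has a direction of negative curvature, within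
`(g x0 - gs) / (c * α ^ 2)` steps with high probability. -/
theorem exists_stepSize (hμ : IsNoise μ M2 M4 s2) (hs2 : 0 < s2) (hL : 0 < L) (hρ : 0 ≤ ρ)
    {ε γ p c : ℝ} (hε : 0 < ε) (hγ : 0 < γ) (hp : 0 < p) (hc : 0 < c) :
    ∃ αbar : ℝ, 0 < αbar ∧ ∀ α, 0 < α → α ≤ αbar →
      ∀ {g : E → ℝ} {g' : E → E} {H : E → E →L[ℝ] E} {gs : ℝ}, IsSmoothBelow g g' H L ρ gs →
      ∀ good : Set E, MeasurableSet good →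
      (∀ x ∉ good, ε < ‖g' x‖ ∨ ∃ d, inner ℝ d (H x d) < -γ * ‖d‖ ^ 2) →
      ∀ (x0 : E) (K : ℕ), 0 < K → g x0 - gs ≤ c * α ^ 2 * K →
      transition μ α g' (survival (transition μ α g') goodᶜ K) x0 ≤ ENNReal.ofReal p := by
  have := hμ.isProbabilityMeasure
  have hM2 := hμ.second_nonneg
  have hM4 := hμ.fourth_nonneg
  set s := γ / (4 * (ρ + 1)) with hs
  have hs0 : 0 < s := by positivity
  have hsγ : 4 * ρ * s ≤ γ := by
    have h1 : 4 * (ρ + 1) * s = γ := by rw [hs]; field_simp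
    linarith
  -- A lower bound for `g - gs` at every bad point, whether the gradient or the curvature is to
  -- blame.
  set c0 := min (ε ^ 2 / (4 * L)) (γ * s ^ 2 / 4) with hc0
  have hc0p : 0 < c0 := lt_min (by positivity) (by positivity)
  set Δ := c0 * p / 2 with hΔ
  have hΔ0 : 0 < Δ := by positivity
  set D := L * M2 with hD
  have hD0 : 0 ≤ D := by positivity
  -- The required drift rate; the factor 3 covers `V x0` and two errors, each at most `Δ ≤ V x0`:
  -- the first step and the overshoot `q α² T`.
  set q := 3 / p * c with hq
  have hq0 : 0 < q := by positivity
  set G := 2 * (D + q) with hG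
  have hG0 : 0 < G := by positivity
  set t := 16 * (D + 1 + q) / (γ ^ 2 * s2) with ht
  have ht0 : 0 ≤ t := by positivity
  set K' := (2 * (L + 2) ^ 4 * G ^ 2 + 16 * M2 ^ 2 + 3 * M4) * (t + 2)
      * Real.exp ((1 + 2 * (L + 2) ^ 4) * (t + 2)) with hK'
  clear_value K' t G q D Δ c0 s
  have hev := (eventually_mul_le 1 zero_lt_one).and <| (eventually_mul_le (4 * L) zero_lt_one).and <|
    (eventually_mul_le (L * ρ ^ 2 / 2 * K') (show 0 < γ ^ 2 * s2 / 2 by positivity)).and <|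
    (eventually_mul_le (ρ ^ 2 / 2 * K') zero_lt_one).and <|
    (eventually_mul_le G (show 0 < ε ^ 2 by positivity)).and <|
    (eventually_mul_le D hΔ0).and (eventually_mul_le (q * (t + 2)) hΔ0)
  obtain ⟨αbar, hαbar, hsub⟩ := mem_nhdsGT_iff_exists_Ioc_subset.1 hev
  refine ⟨αbar, hαbar, ?_⟩
  intro α hα hαle g g' H gs h good hgood hbad x0 K hK hKle
  obtain ⟨hα1, hαL, hα2, hα3, hαε, hαD, hαq⟩ := hsub ⟨hα, hαle⟩
  rw [one_mul] at hα1
  have hQ := isMarkovOperator_transition μ α h.continuous_gradient.measurable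
  set Q := transition μ α g' with hQdef
  set V : E → ℝ≥0∞ := fun x => ENNReal.ofReal (g x - gs) with hV
  have hVm : Measurable V := (h.continuous.sub continuous_const).measurable.ennreal_ofReal
  have hx0 : 0 ≤ g x0 - gs := sub_nonneg.2 (h.below x0)
  have hQV : Q V x0 ≤ ENNReal.ofReal (g x0 - gs + Δ) := by
    have h1 := le_of_add_le_left (h.lintegral_step_le hμ hL hα hαL x0)
    refine h1.trans ?_
    rw [← ENNReal.ofReal_add hx0 (by positivity)]
    refine ENNReal.ofReal_le_ofReal ?_
    have h2 : D * α * α ≤ D * α * 1 := by gcongr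
    have h3 : L * α ^ 2 * M2 = D * α * α := by rw [hD]; ring
    linarith
  -- For a small initial excess `K` may be too small for the drift bound, but then `E V(X₁) ≤ 2Δ =
  -- c0 p`, and Markov's inequality bounds the chance that the first iterate is bad.
  rcases le_total (g x0 - gs) Δ with hsmall | hlarge
  · have hge : ∀ x ∉ good, c0 ≤ g x - gs := by
      intro x hx
      rcases hbad x hx with h1 | ⟨d, hd⟩
      · refine hc0.le.trans ((min_le_left _ _).trans ?_)
        rw [div_le_iff₀ (by positivity)]
        have h2 := h.norm_gradient_sq_le hL x
        have h3 : ε ^ 2 ≤ ‖g' x‖ ^ 2 := by gcongr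
        linarith
      · refine hc0.le.trans ((min_le_right _ _).trans ?_)
        obtain ⟨e, he, η, hγη, hHe⟩ := exists_unit_eigenvector_of_inner_lt (h.hessian_symm x) hd
        refine h.le_of_curvature hρ hs0.le hsγ (x := x) (d := e) ?_ he
        rw [hHe, inner_smul_right, real_inner_self_eq_norm_sq, he]
        linarith
    have h1 : (fun x => ENNReal.ofReal c0 * survival Q goodᶜ K x) ≤ V := by
      intro x
      by_cases hx : x ∈ good
      · obtain ⟨j, rfl⟩ := Nat.exists_eq_add_of_lt hK
        simp [survival, hx]
      · calc ENNReal.ofReal c0 * survival Q goodᶜ K x ≤ ENNReal.ofReal c0 * 1 := by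
              gcongr; exact survival_antitone hQ (Nat.zero_le K) x
          _ ≤ V x := by rw [mul_one]; exact ENNReal.ofReal_le_ofReal (hge x hx)
    have h2 := hQ.mono h1 x0
    rw [hQ.const_mul _ _ ENNReal.ofReal_ne_top] at h2
    have h3 : ENNReal.ofReal c0 * Q (survival Q goodᶜ K) x0
        ≤ ENNReal.ofReal c0 * ENNReal.ofReal p := by
      refine (h2.trans hQV).trans ?_
      rw [← ENNReal.ofReal_mul hc0p.le]
      exact ENNReal.ofReal_le_ofReal (by linarith)
    exact (ENNReal.mul_le_mul_iff_right (ENNReal.ofReal_pos.2 hc0p).ne' ENNReal.ofReal_ne_top).1 h3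
  · set T := ⌈t / α⌉₊ + 1 with hT
    have hT2 : T * α ≤ t + 2 := by
      rw [hT]; push_cast
      have h1 := mul_le_mul_of_nonneg_right (Nat.ceil_lt_add_one (div_nonneg ht0 hα.le)).le hα.le
      have h2 : t / α * α = t := by field_simp
      linarith
    have hdrift : ∀ x ∈ goodᶜ, ∃ i, 0 < i ∧ i ≤ T ∧
        Q^[i] V x + ENNReal.ofReal (q * α ^ 2) * i ≤ V x := by
      intro x hx
      -- Above the threshold `G α` one step pays for noise and drift. Below it the gradient norm is
      -- at most `ε`, so a bad point must have negative curvature.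
      rcases lt_or_ge (G * α) (‖g' x‖ ^ 2) with hlt | hge
      · refine ⟨1, one_pos, by omega, ?_⟩
        have h1 := h.lintegral_step_le hμ hL hα hαL x
        have h2 : ENNReal.ofReal (q * α ^ 2) + ENNReal.ofReal (L * α ^ 2 * M2)
            ≤ ENNReal.ofReal (α / 2 * ‖g' x‖ ^ 2) := by
          rw [← ENNReal.ofReal_add (by positivity) (by positivity)]
          refine ENNReal.ofReal_le_ofReal ?_
          have h3 := mul_le_mul_of_nonneg_left hlt.le (show 0 ≤ α / 2 by positivity)
          rw [hG, hD] at h3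
          linarith
        have h3 := (add_le_add_right h2 _).trans h1
        rw [← add_assoc] at h3
        have h4 := (ENNReal.add_le_add_iff_right ENNReal.ofReal_ne_top).1 h3
        rw [Function.iterate_one, Nat.cast_one, mul_one]
        exact h4
      · refine ⟨T, by omega, le_rfl, ?_⟩
        refine h.saddle_drift hμ hs2 hL hρ hα hα1 hαL hγ (sq_nonneg G) hq0.le (hD ▸ ht) hK' hα2 hα3 ?_ ?_
        · calc ‖g' x‖ ^ 4 = (‖g' x‖ ^ 2) ^ 2 := by ring
            _ ≤ (G * α) ^ 2 := by gcongr
            _ = _ := by ring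
        · refine (hbad x hx).resolve_left fun h1 => ?_
          have : ε ^ 2 < ‖g' x‖ ^ 2 := by gcongr
          linarith
    have h1 : (fun x => (ENNReal.ofReal (q * α ^ 2) * K) * survival Q goodᶜ K x)
        ≤ V + fun _ => ENNReal.ofReal (q * α ^ 2) * T :=
      fun x => mul_survival_le hQ hgood.compl hVm ENNReal.ofReal_ne_top hdrift K x
    have h2 := hQ.mono h1 x0
    have hne : ENNReal.ofReal (q * α ^ 2) * K ≠ ∞ :=
      ENNReal.mul_ne_top ENNReal.ofReal_ne_top (ENNReal.natCast_ne_top K)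
    have hK0 : (0 : ℝ) < K := by exact_mod_cast hK
    rw [hQ.const_mul _ _ hne, hQ.add _ hVm, hQ.const] at h2
    have h3 : ENNReal.ofReal (q * α ^ 2) * K * Q (survival Q goodᶜ K) x0
        ≤ ENNReal.ofReal (q * α ^ 2) * K * ENNReal.ofReal p := by
      refine (h2.trans (add_le_add_left hQV _)).trans ?_
      rw [← ENNReal.ofReal_natCast T, ← ENNReal.ofReal_natCast K,
        ← ENNReal.ofReal_mul (by positivity), ← ENNReal.ofReal_mul (by positivity),
        ← ENNReal.ofReal_mul (by positivity), ← ENNReal.ofReal_add (by positivity) (by positivity)]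
      refine ENNReal.ofReal_le_ofReal ?_
      have h4 : q * α ^ 2 * T ≤ Δ := by
        have : q * α * (T * α) ≤ q * α * (t + 2) := by gcongr
        linarith
      have h5 : q * α ^ 2 * K * p = 3 * (c * α ^ 2 * K) := by rw [hq]; field_simp
      linarith
    refine (ENNReal.mul_le_mul_iff_right ?_ hne).1 h3
    exact mul_ne_zero (ENNReal.ofReal_pos.2 (by positivity)).ne' (by exact_mod_cast hK.ne')

end Abstract

/-! ### From the random process to the transition operator -/

section PerturbedDescent

variable {E : Type*} [NormedAddCommGroup E] [InnerProductSpace ℝ E]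
  [MeasurableSpace E] [BorelSpace E] [SecondCountableTopology E]
  {Ω : Type*} {mΩ : MeasurableSpace Ω} {P : Measure Ω} {μ : Measure E}
  {α : ℝ} {g' : E → E} {W X : ℕ → Ω → E} {x0 : E}

/-- The σ-algebra generated by the first `k` variables of a sequence. -/
@[reducible] def pastAlgebra (W : ℕ → Ω → E) (k : ℕ) : MeasurableSpace Ω :=
  ⨆ i ∈ {i : ℕ | i < k}, MeasurableSpace.comap (W i) inferInstance

omit [NormedAddCommGroup E] [InnerProductSpace ℝ E] [BorelSpace E] [SecondCountableTopology E] in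
theorem pastAlgebra_mono {i j : ℕ} (hij : i ≤ j) : pastAlgebra W i ≤ pastAlgebra W j :=
  biSup_mono fun _ hl => lt_of_lt_of_le hl hij

omit [NormedAddCommGroup E] [InnerProductSpace ℝ E] [BorelSpace E] [SecondCountableTopology E] in
theorem pastAlgebra_le (hW : ∀ k, Measurable (W k)) (k : ℕ) : pastAlgebra W k ≤ mΩ :=
  iSup₂_le fun i _ => (hW i).comap_le

omit [NormedAddCommGroup E] [InnerProductSpace ℝ E] [BorelSpace E] [SecondCountableTopology E] in
theorem measurable_pastAlgebra (k : ℕ) : Measurable[pastAlgebra W (k + 1)] (W k) :=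
  Measurable.of_comap_le (le_iSup₂_of_le k (Nat.lt_succ_self k) le_rfl)

/-- Each variable of the sequence is independent of its predecessors. -/
def IndepPast (W : ℕ → Ω → E) (P : Measure Ω) : Prop :=
  ∀ k, Indep (pastAlgebra W k) (MeasurableSpace.comap (W k) inferInstance) P

omit [NormedAddCommGroup E] [InnerProductSpace ℝ E] [BorelSpace E] [SecondCountableTopology E] in
theorem IndepPast.indepFun (hind : IndepPast W P) {F : Type*} [MeasurableSpace F] {Z : Ω → F}
    {k : ℕ} (hZ : Measurable[pastAlgebra W k] Z) : IndepFun Z (W k) P := by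
  rw [IndepFun_iff_Indep]
  exact indep_of_indep_of_le_left (hind k) hZ.comap_le

variable [IsProbabilityMeasure P]

/-- Integration over the most recent noise variable is the transition operator. -/
theorem lintegral_mul_step (hind : IndepPast W P) (hW : ∀ k, Measurable (W k))
    (hlaw : ∀ k, P.map (W k) = μ) (hg' : Measurable g') {k : ℕ} {a : Ω → ℝ≥0∞}
    (ha : Measurable[pastAlgebra W k] a) {Y : Ω → E} (hY : Measurable[pastAlgebra W k] Y)
    {h : E → ℝ≥0∞} (hh : Measurable h) :
    ∫⁻ ω, a ω * h (step α g' (Y ω) (W k ω)) ∂P = ∫⁻ ω, a ω * transition μ α g' h (Y ω) ∂P := by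
  have : IsProbabilityMeasure μ := hlaw 0 ▸ Measure.isProbabilityMeasure_map (hW 0).aemeasurable
  have hle := pastAlgebra_le hW k
  have hZ : Measurable[pastAlgebra W k] fun ω => (a ω, Y ω) := ha.prodMk hY
  have hind' := hind.indepFun hZ
  have hZ' : Measurable fun ω => (a ω, Y ω) := hZ.mono hle le_rfl
  have hmap := (indepFun_iff_map_prod_eq_prod_map_map hZ'.aemeasurable (hW k).aemeasurable).1 hind'
  rw [hlaw k] at hmap
  have hφ : Measurable fun z : (ℝ≥0∞ × E) × E => z.1.1 * h (step α g' z.1.2 z.2) :=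
    (measurable_fst.comp measurable_fst).mul (hh.comp ((measurable_step hg').comp
      ((measurable_snd.comp measurable_fst).prodMk measurable_snd)))
  calc ∫⁻ ω, a ω * h (step α g' (Y ω) (W k ω)) ∂P
      = ∫⁻ z, z.1.1 * h (step α g' z.1.2 z.2) ∂(P.map fun ω => ((a ω, Y ω), W k ω)) :=
        (lintegral_map hφ (hZ'.prodMk (hW k))).symm
    _ = ∫⁻ z, ∫⁻ n, z.1 * h (step α g' z.2 n) ∂μ ∂(P.map fun ω => (a ω, Y ω)) := by
        rw [hmap, lintegral_prod _ hφ.aemeasurable]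
    _ = ∫⁻ ω, ∫⁻ n, a ω * h (step α g' (Y ω) n) ∂μ ∂P :=
        lintegral_map hφ.lintegral_prod_right' hZ'
    _ = _ := by
        refine lintegral_congr fun ω => ?_
        exact lintegral_const_mul _ (hh.comp ((measurable_step hg').comp measurable_prodMk_left))

theorem measurable_process (hg' : Measurable g') (hX0 : ∀ ω, X 0 ω = x0)
    (hX : ∀ k ω, X (k + 1) ω = step α g' (X k ω) (W k ω)) (k : ℕ) :
    Measurable[pastAlgebra W k] (X k) := by
  induction k with
  | zero =>
    have : X 0 = fun _ => x0 := funext hX0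
    rw [this]
    exact @measurable_const _ _ _ (pastAlgebra W 0) _
  | succ k ih =>
    have : X (k + 1) = fun ω => step α g' (X k ω) (W k ω) := funext (hX k)
    rw [this]
    exact (measurable_step hg').comp
      ((ih.mono (pastAlgebra_mono k.le_succ) le_rfl).prodMk (measurable_pastAlgebra k))

/-- The probability that perturbed gradient descent stays in `bad` at the times `1, …, K`. -/
theorem measure_forall_mem_eq (hind : IndepPast W P) (hW : ∀ k, Measurable (W k))
    (hlaw : ∀ k, P.map (W k) = μ) (hg' : Measurable g') (hX0 : ∀ ω, X 0 ω = x0)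
    (hX : ∀ k ω, X (k + 1) ω = step α g' (X k ω) (W k ω)) {bad : Set E} (hbad : MeasurableSet bad)
    (K : ℕ) : P {ω | ∀ k, 0 < k → k ≤ K → X k ω ∈ bad}
      = transition μ α g' (survival (transition μ α g') bad K) x0 := by
  have : IsProbabilityMeasure μ := hlaw 0 ▸ Measure.isProbabilityMeasure_map (hW 0).aemeasurable
  have hQ := isMarkovOperator_transition μ α hg'
  set Q := transition μ α g' with hQdef
  have hXm := measurable_process hg' hX0 hX
  set a : ℕ → Ω → ℝ≥0∞ := fun i ω => ∏ l ∈ Finset.range i, bad.indicator 1 (X (l + 1) ω) with ha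
  have ham : ∀ i, Measurable[pastAlgebra W i] (a i) := by
    intro i
    refine Finset.measurable_prod (m := pastAlgebra W i) _ fun l hl => ?_
    have h1 : Measurable (bad.indicator (1 : E → ℝ≥0∞)) := measurable_one.indicator hbad
    exact h1.comp ((hXm (l + 1)).mono (pastAlgebra_mono (Finset.mem_range.1 hl)) le_rfl)
  -- The integral is constant along `i + j = K`: each step trades one application of the transition
  -- operator for the indicator at time `i + 1`. Its two ends are the operator expression and the
  -- probability. The outer `Q` is there because time 0 is not tested.
  have key : ∀ i j, i + j = K →
      ∫⁻ ω, a i ω * Q (survival Q bad j) (X i ω) ∂P = Q (survival Q bad K) x0 := by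
    intro i
    induction i with
    | zero =>
      rintro j hj
      rw [zero_add] at hj
      simp [ha, hX0, hj]
    | succ i ih =>
      intro j hj
      rw [← ih (j + 1) (by omega), ← lintegral_mul_step hind hW hlaw hg' (ham i) (hXm i)
        (measurable_survival hQ hbad (j + 1))]
      refine lintegral_congr fun ω => ?_
      rw [← hX i ω]
      by_cases hω : X (i + 1) ω ∈ bad <;>
        simp [ha, Finset.prod_range_succ, survival, hω]
  rw [← key K 0 (by simp)]
  set S := {ω | ∀ k, 0 < k → k ≤ K → X k ω ∈ bad} with hSdef
  have hS : MeasurableSet S := by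
    have : S = ⋂ k, ⋂ (_ : 0 < k), ⋂ (_ : k ≤ K), X k ⁻¹' bad := by ext; simp [hSdef]
    rw [this]
    exact MeasurableSet.iInter fun k => MeasurableSet.iInter fun _ => MeasurableSet.iInter fun _ =>
      (hXm k).mono (pastAlgebra_le hW k) le_rfl hbad
  rw [← lintegral_indicator_one hS]
  refine lintegral_congr fun ω => ?_
  simp only [survival, hQ.const, mul_one, ha]
  have hωS : ω ∈ S ↔ ∀ k, 0 < k → k ≤ K → X k ω ∈ bad := Iff.rfl
  by_cases hω : ω ∈ S
  · rw [Set.indicator_of_mem hω]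
    symm
    refine Finset.prod_eq_one fun l hl => ?_
    rw [Set.indicator_of_mem (hωS.1 hω (l + 1) (by omega) (by simpa using hl))]
    rfl
  · rw [Set.indicator_of_notMem hω]
    symm
    rw [hωS] at hω
    push Not at hω
    obtain ⟨k, hk0, hkK, hk⟩ := hω
    refine Finset.prod_eq_zero (i := k - 1) (by simp; omega) ?_
    rw [Nat.sub_add_cancel hk0, Set.indicator_of_notMem hk]

end PerturbedDescent

/-! ### Isotropic Gaussian noise -/

section GaussianNoise

variable {E : Type*} [NormedAddCommGroup E] [InnerProductSpace ℝ E] [FiniteDimensional ℝ E]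
  [MeasurableSpace E] [BorelSpace E]

/-- The centred Gaussian law on `E` with covariance `σ ^ 2` times the identity. -/
noncomputable def gaussianNoise (E : Type*) [NormedAddCommGroup E] [InnerProductSpace ℝ E]
    [FiniteDimensional ℝ E] [MeasurableSpace E] [BorelSpace E] (σ : ℝ) : Measure E :=
  (stdGaussian E).map fun x => σ • x

theorem isNoise_gaussianNoise (σ : ℝ) : IsNoise (gaussianNoise E σ)
    (∫ n, ‖n‖ ^ 2 ∂gaussianNoise E σ) (∫ n, ‖n‖ ^ 4 ∂gaussianNoise E σ) (σ ^ 2) where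
  isProbabilityMeasure := Measure.isProbabilityMeasure_map (by fun_prop)
  memLp := by
    rw [gaussianNoise, memLp_map_measure_iff (by fun_prop) (by fun_prop)]
    exact (IsGaussian.memLp_id (stdGaussian E) 4 (by norm_num)).const_smul σ
  mean u := by
    rw [gaussianNoise, integral_map (by fun_prop) (by fun_prop)]
    have h := integral_strongDual_stdGaussian (innerSL ℝ u)
    simp only [innerSL_apply_apply] at h
    simp [inner_smul_right, integral_const_mul, h]
  second := rfl
  fourth := rfl
  direction e he := by
    rw [gaussianNoise, integral_map (by fun_prop) (by fun_prop)]
    have h := integral_strongDual_stdGaussian (innerSL ℝ e)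
    have h2 := variance_dual_stdGaussian (innerSL ℝ e)
    rw [variance_of_integral_eq_zero (by fun_prop) h, innerSL_apply_norm, he] at h2
    simp only [innerSL_apply_apply] at h2
    simp [inner_smul_right, mul_pow, integral_const_mul, h2]

theorem charFun_gaussianNoise (σ : ℝ) (t : E) :
    charFun (gaussianNoise E σ) t = Complex.exp (-(σ ^ 2 * ‖t‖ ^ 2 : ℝ) / 2) := by
  rw [gaussianNoise, charFun_map_smul, charFun_stdGaussian, norm_smul]
  congr 2
  push_cast
  rw [mul_pow, ← Complex.ofReal_pow ‖σ‖, Real.norm_eq_abs, sq_abs]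
  push_cast
  ring

/-- Stacking independent isotropic Gaussian vectors gives an isotropic Gaussian vector. -/
theorem map_toLp_eq_gaussianNoise {m n : ℕ} {Ω : Type*} [MeasurableSpace Ω] {P : Measure Ω}
    [IsProbabilityMeasure P] {Y : Fin m → Ω → EuclideanSpace ℝ (Fin n)} (hY : ∀ i, Measurable (Y i))
    {σ : ℝ} (hlaw : ∀ i, P.map (Y i) = multivariateGaussian 0 ((σ ^ 2) • 1))
    (hind : iIndepFun Y P) :
    P.map (fun ω => WithLp.toLp 2 fun i => Y i ω) = gaussianNoise (Stack m n) σ := by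
  have h1 : Measurable fun ω => (WithLp.toLp 2 fun i => Y i ω : Stack m n) :=
    (WithLp.measurable_toLp 2 _).comp (measurable_pi_lambda _ hY)
  have : IsProbabilityMeasure (P.map fun ω => (WithLp.toLp 2 fun i => Y i ω : Stack m n)) :=
    Measure.isProbabilityMeasure_map h1.aemeasurable
  have : IsProbabilityMeasure (gaussianNoise (Stack m n) σ) :=
    (isNoise_gaussianNoise σ).isProbabilityMeasure
  refine Measure.ext_of_charFun (funext fun t => ?_)
  have hpsd : ((σ ^ 2) • (1 : Matrix (Fin n) (Fin n) ℝ)).PosSemidef :=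
    Matrix.PosSemidef.one.smul (sq_nonneg σ)
  rw [(iIndepFun_iff_charFun_pi fun i => (hY i).aemeasurable).1 hind t, charFun_gaussianNoise]
  have h2 : ∀ i, charFun (P.map (Y i)) (t i) = Complex.exp (-(σ ^ 2 * ‖t i‖ ^ 2 : ℝ) / 2) := by
    intro i
    rw [hlaw i, charFun_multivariateGaussian hpsd, inner_zero_right]
    have h3 : (t i).ofLp ⬝ᵥ ((σ ^ 2) • (1 : Matrix (Fin n) (Fin n) ℝ)).mulVec (t i).ofLp
        = σ ^ 2 * ‖t i‖ ^ 2 := by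
      rw [Matrix.smul_mulVec, Matrix.one_mulVec, dotProduct_smul, EuclideanSpace.real_norm_sq_eq]
      simp [dotProduct, sq]
    rw [h3]
    congr 1
    push_cast
    ring
  rw [Finset.prod_congr rfl fun i _ => h2 i, ← Complex.exp_sum]
  congr 1
  rw [PiLp.norm_sq_eq_of_L2]
  push_cast
  rw [Finset.mul_sum, ← Finset.sum_div, Finset.sum_neg_distrib]

end GaussianNoise

/-! ### Smoothness under affine substitution and separable sums -/

section Smoothness

variable {E : Type*} [NormedAddCommGroup E] [InnerProductSpace ℝ E] [CompleteSpace E]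

theorem isSmoothBelow_of_contDiff {f : E → ℝ} (hf : ContDiff ℝ 2 f) {Lg LH : ℝ≥0}
    (hLg : LipschitzWith Lg (gradient f)) (hLH : LipschitzWith LH (fderiv ℝ (gradient f)))
    (hb : BddBelow (Set.range f)) :
    IsSmoothBelow f (gradient f) (fderiv ℝ (gradient f)) Lg LH (⨅ x, f x) := by
  have hd : Differentiable ℝ f := hf.differentiable (by norm_num)
  have hd2 : Differentiable ℝ (fderiv ℝ f) :=
    (hf.fderiv_right (m := 1) (by norm_num)).differentiable (by norm_num)
  let Φ : StrongDual ℝ E →L[ℝ] E :=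
    { toFun := (InnerProductSpace.toDual ℝ E).symm
      map_add' := map_add _
      map_smul' := fun c x => by simp
      cont := (InnerProductSpace.toDual ℝ E).symm.continuous }
  have hgrad : ∀ x, HasFDerivAt (gradient f) (Φ.comp (fderiv ℝ (fderiv ℝ f) x)) x := fun x =>
    Φ.hasFDerivAt.comp x (hd2 x).hasFDerivAt
  refine ⟨fun x => (hd x).hasGradientAt, fun x => (hgrad x).differentiableAt.hasFDerivAt,
    fun x y => ?_, fun x y => ?_, fun x u v => ?_, fun x => ciInf_le hb x⟩
  · simpa [dist_eq_norm] using hLg.dist_le_mul x y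
  · simpa [dist_eq_norm] using hLH.dist_le_mul x y
  · have hsymm := second_derivative_symmetric (fun y => (hd y).hasFDerivAt) (hd2 x).hasFDerivAt
    have h1 : ∀ a b, inner ℝ (fderiv ℝ (gradient f) x a) b = fderiv ℝ (fderiv ℝ f) x a b := by
      intro a b
      rw [(hgrad x).fderiv]
      exact InnerProductSpace.toDual_symm_apply
    simp only [ContinuousLinearMap.coe_coe]
    rw [h1, real_inner_comm, h1, hsymm]

/-- Precomposition with an affine map whose linear part is symmetric. -/
theorem IsSmoothBelow.comp_affine {g : E → ℝ} {g' : E → E} {H : E → E →L[ℝ] E} {L ρ gs : ℝ}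
    (h : IsSmoothBelow g g' H L ρ gs) (hL : 0 ≤ L) (hρ : 0 ≤ ρ) (z : E) {A : E →L[ℝ] E}
    (hA : (A : E →ₗ[ℝ] E).IsSymmetric) :
    IsSmoothBelow (fun x => g (z + A x)) (fun x => A (g' (z + A x)))
      (fun x => A ∘L H (z + A x) ∘L A) (‖A‖ ^ 2 * L) (‖A‖ ^ 3 * ρ) gs := by
  have hA' : ∀ x y, inner ℝ (A x) y = inner ℝ x (A y) := hA
  have haff : ∀ x, HasFDerivAt (fun x => z + A x) A x := fun x => A.hasFDerivAt.const_add z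
  have hsub : ∀ x y, ‖z + A x - (z + A y)‖ ≤ ‖A‖ * ‖x - y‖ := fun x y => by
    rw [add_sub_add_left_eq_sub, ← map_sub]; exact A.le_opNorm _
  refine ⟨fun x => ?_, fun x => ?_, fun x y => ?_, fun x y => ?_, fun x u v => ?_,
    fun x => h.below _⟩
  · rw [hasGradientAt_iff_hasFDerivAt]
    refine ((h.hasGradient (z + A x)).hasFDerivAt.comp x (haff x)).congr_fderiv ?_
    ext v
    simp [hA']
  · exact A.hasFDerivAt.comp x ((h.hasHessian (z + A x)).comp x (haff x))
  · rw [← map_sub]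
    calc _ ≤ ‖A‖ * ‖g' (z + A x) - g' (z + A y)‖ := A.le_opNorm _
      _ ≤ ‖A‖ * (L * ‖z + A x - (z + A y)‖) := by gcongr; exact h.gradient_lip _ _
      _ ≤ ‖A‖ * (L * (‖A‖ * ‖x - y‖)) := by gcongr; exact hsub x y
      _ = _ := by ring
  · rw [← ContinuousLinearMap.comp_sub, ← ContinuousLinearMap.sub_comp]
    calc _ ≤ ‖A‖ * (‖H (z + A x) - H (z + A y)‖ * ‖A‖) :=
          (ContinuousLinearMap.opNorm_comp_le _ _).trans (by
            gcongr; exact ContinuousLinearMap.opNorm_comp_le _ _)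
      _ ≤ ‖A‖ * (ρ * ‖z + A x - (z + A y)‖ * ‖A‖) := by gcongr; exact h.hessian_lip _ _
      _ ≤ ‖A‖ * (ρ * (‖A‖ * ‖x - y‖) * ‖A‖) := by gcongr; exact hsub x y
      _ = _ := by ring
  · have := h.hessian_symm (z + A x) (A u) (A v)
    simp only [ContinuousLinearMap.coe_coe, ContinuousLinearMap.comp_apply] at this ⊢
    rw [hA', this, hA']

theorem IsSmoothBelow.mono {g : E → ℝ} {g' : E → E} {H : E → E →L[ℝ] E} {L L' ρ gs : ℝ}
    (h : IsSmoothBelow g g' H L ρ gs) (hL : L ≤ L') : IsSmoothBelow g g' H L' ρ gs :=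
  { h with gradient_lip := fun x y => (h.gradient_lip x y).trans (by gcongr) }

theorem norm_toLp_le {m : ℕ} {F : Type*} [NormedAddCommGroup F] {c : ℝ} (hc : 0 ≤ c)
    {u v : PiLp 2 fun _ : Fin m => F} (h : ∀ i, ‖u i‖ ≤ c * ‖v i‖) : ‖u‖ ≤ c * ‖v‖ := by
  refine le_of_sq_le_sq ?_ (by positivity)
  rw [mul_pow, PiLp.norm_sq_eq_of_L2, PiLp.norm_sq_eq_of_L2, Finset.mul_sum]
  gcongr with i
  rw [← mul_pow]
  gcongr
  exact h i

/-- The block diagonal operator with the given blocks. -/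
noncomputable def blockDiag {m : ℕ} {F : Type*} [NormedAddCommGroup F] [InnerProductSpace ℝ F]
    (T : Fin m → F →L[ℝ] F) : (PiLp 2 fun _ : Fin m => F) →L[ℝ] PiLp 2 fun _ : Fin m => F :=
  ((PiLp.continuousLinearEquiv 2 ℝ fun _ : Fin m => F).symm.toContinuousLinearMap).comp
    (ContinuousLinearMap.pi fun i => (T i).comp (PiLp.proj 2 (fun _ : Fin m => F) i))

theorem blockDiag_apply {m : ℕ} {F : Type*} [NormedAddCommGroup F] [InnerProductSpace ℝ F]
    (T : Fin m → F →L[ℝ] F) (v : PiLp 2 fun _ : Fin m => F) (i : Fin m) :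
    blockDiag T v i = T i (v i) := rfl

/-- A separable sum of smooth functions is smooth. -/
theorem isSmoothBelow_sum {m : ℕ} {f : Fin m → E → ℝ} {f' : Fin m → E → E}
    {H : Fin m → E → E →L[ℝ] E} {L ρ fs : Fin m → ℝ}
    (h : ∀ i, IsSmoothBelow (f i) (f' i) (H i) (L i) (ρ i) (fs i)) {L' ρ' : ℝ} (hL0 : 0 ≤ L')
    (hρ0 : 0 ≤ ρ') (hL : ∀ i, L i ≤ L') (hρ : ∀ i, ρ i ≤ ρ') :
    IsSmoothBelow (fun θ : PiLp 2 fun _ : Fin m => E => ∑ i, f i (θ i))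
      (fun θ => WithLp.toLp 2 fun i => f' i (θ i)) (fun θ => blockDiag fun i => H i (θ i))
      L' ρ' (∑ i, fs i) := by
  have hproj : ∀ i (θ : PiLp 2 fun _ : Fin m => E), HasFDerivAt
      (fun θ : PiLp 2 fun _ : Fin m => E => θ i) (PiLp.proj 2 (fun _ : Fin m => E) i) θ :=
    fun i θ => (PiLp.proj 2 (𝕜 := ℝ) (fun _ : Fin m => E) i).hasFDerivAt
  refine ⟨fun θ => ?_, fun θ => ?_, fun θ η => ?_, fun θ η => ?_, fun θ u v => ?_,
    fun θ => Finset.sum_le_sum fun i _ => (h i).below _⟩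
  · rw [hasGradientAt_iff_hasFDerivAt]
    refine (HasFDerivAt.fun_sum fun i _ =>
      ((h i).hasGradient (θ i)).hasFDerivAt.comp θ (hproj i θ)).congr_fderiv ?_
    ext v
    simp [PiLp.inner_apply]
  · refine ((PiLp.continuousLinearEquiv 2 ℝ fun _ : Fin m => E).symm.hasFDerivAt).comp θ ?_
    rw [hasFDerivAt_pi]
    exact fun i => ((h i).hasHessian (θ i)).comp θ (hproj i θ)
  · refine norm_toLp_le hL0 fun i => ((h i).gradient_lip (θ i) (η i)).trans ?_
    exact mul_le_mul_of_nonneg_right (hL i) (norm_nonneg _)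
  · refine ContinuousLinearMap.opNorm_le_bound _ (by positivity) fun d => ?_
    refine norm_toLp_le (by positivity) fun i => ?_
    have h1 := (H i (θ i) - H i (η i)).le_opNorm (d i)
    refine h1.trans (mul_le_mul_of_nonneg_right (((h i).hessian_lip _ _).trans ?_) (norm_nonneg _))
    refine mul_le_mul (hρ i) ?_ (norm_nonneg _) hρ0
    exact PiLp.norm_apply_le (θ - η) i
  · simp only [ContinuousLinearMap.coe_coe, PiLp.inner_apply, blockDiag_apply]
    exact Finset.sum_congr rfl fun i _ => (h i).hessian_symm (θ i) (u i) (v i)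

end Smoothness

/-! ### The Laplacian, its square root and zero-sum vectors -/

section Laplacian

variable {m n : ℕ} (G : SimpleGraph (Fin m)) [DecidableRel G.Adj]

theorem kronAct_apply (M : Matrix (Fin m) (Fin m) ℝ) (v : Stack m n) (i : Fin m) :
    kronAct M v i = ∑ j, M i j • v j := rfl

theorem kronAct_kronAct (M N : Matrix (Fin m) (Fin m) ℝ) (v : Stack m n) :
    kronAct M (kronAct N v) = kronAct (M * N) v := by
  ext i : 1
  simp only [kronAct_apply, Finset.smul_sum, smul_smul, Matrix.mul_apply, Finset.sum_smul]
  exact Finset.sum_comm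

theorem kronAct_add (M : Matrix (Fin m) (Fin m) ℝ) (u v : Stack m n) :
    kronAct M (u + v) = kronAct M u + kronAct M v := by
  ext i : 1
  simp [kronAct_apply, Finset.sum_add_distrib]

theorem kronAct_smul (M : Matrix (Fin m) (Fin m) ℝ) (c : ℝ) (v : Stack m n) :
    kronAct M (c • v) = c • kronAct M v := by
  ext i : 1
  simp [kronAct_apply, Finset.smul_sum, smul_comm c]

theorem continuous_kronAct (M : Matrix (Fin m) (Fin m) ℝ) :
    Continuous (kronAct M : Stack m n → Stack m n) := by
  unfold kronAct
  fun_prop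

/-- The action of `M ⊗ I_n` as a continuous linear map. -/
def kronCLM (M : Matrix (Fin m) (Fin m) ℝ) : Stack m n →L[ℝ] Stack m n where
  toFun := kronAct M
  map_add' := kronAct_add M
  map_smul' := kronAct_smul M
  cont := continuous_kronAct M

@[simp] theorem kronCLM_apply (M : Matrix (Fin m) (Fin m) ℝ) (v : Stack m n) :
    kronCLM M v = kronAct M v := rfl

theorem isSymmetric_kronCLM {M : Matrix (Fin m) (Fin m) ℝ} (hM : M.IsSymm) :
    ((kronCLM M : Stack m n →L[ℝ] Stack m n) : Stack m n →ₗ[ℝ] Stack m n).IsSymmetric := by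
  intro u v
  simp only [ContinuousLinearMap.coe_coe, kronCLM_apply]
  rw [PiLp.inner_apply, PiLp.inner_apply]
  simp only [kronAct_apply, sum_inner, inner_sum, inner_smul_left, inner_smul_right, conj_trivial]
  rw [Finset.sum_comm]
  exact Finset.sum_congr rfl fun i _ => Finset.sum_congr rfl fun j _ => by rw [hM.apply]

theorem sqrtLap_mul_self : sqrtLap G * sqrtLap G = G.lapMatrix ℝ :=
  CFC.sqrt_mul_sqrt_self _ (Matrix.nonneg_iff_posSemidef.2 (G.posSemidef_lapMatrix ℝ))

theorem isSymm_sqrtLap : (sqrtLap G).IsSymm := by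
  have h : (sqrtLap G).PosSemidef := Matrix.nonneg_iff_posSemidef.1 (CFC.sqrt_nonneg _)
  have h1 := h.isHermitian
  rwa [Matrix.IsHermitian, Matrix.conjTranspose_eq_transpose_of_trivial] at h1

/-- By symmetry `‖√L 1‖² = 1ᵀ L 1 = 0`. -/
theorem sqrtLap_mulVec_one : (sqrtLap G).mulVec (fun _ => 1) = 0 := by
  rw [← dotProduct_self_eq_zero, Matrix.dotProduct_mulVec, ← Matrix.mulVec_transpose,
    (isSymm_sqrtLap G).eq, Matrix.mulVec_mulVec, sqrtLap_mul_self,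
    SimpleGraph.lapMatrix_mulVec_const_eq_zero, zero_dotProduct]

theorem sum_kronAct_sqrtLap (v : Stack m n) : ∑ i, kronAct (sqrtLap G) v i = 0 := by
  simp only [kronAct_apply]
  rw [Finset.sum_comm]
  refine Finset.sum_eq_zero fun j _ => ?_
  have h := congrFun (sqrtLap_mulVec_one G) j
  simp only [Matrix.mulVec, dotProduct, mul_one, Pi.zero_apply] at h
  rw [← Finset.sum_smul]
  simp only [fun i => (isSymm_sqrtLap G).apply j i, h, zero_smul]

variable {G}

theorem lapMatrix_ne_zero (hm : 2 ≤ m) (hG : G.Connected) : G.lapMatrix ℝ ≠ 0 := by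
  intro h
  have h1 := (G.lapMatrix_mulVec_eq_zero_iff_forall_reachable
    (x := Pi.single (⟨0, by omega⟩ : Fin m) 1)).1 (by rw [h, Matrix.zero_mulVec])
    ⟨0, by omega⟩ ⟨1, by omega⟩ (hG.preconnected _ _)
  simp at h1

theorem specNorm_sqrtLap_pos (hm : 2 ≤ m) (hG : G.Connected) : 0 < specNorm (sqrtLap G) := by
  refine norm_pos_iff.2 fun h => ?_
  have h1 : sqrtLap G = 0 := by simpa using h
  have h2 := sqrtLap_mul_self G
  rw [h1, zero_mul] at h2
  exact lapMatrix_ne_zero hm hG h2.symm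

/-- The non-zero eigenvalues form a finite set, non-empty because `L ≠ 0`, so the infimum is
attained; semidefiniteness excludes a negative value. -/
theorem lambdaMinPos_lapMatrix_pos (hm : 2 ≤ m) (hG : G.Connected) :
    0 < lambdaMinPos (G.lapMatrix ℝ) := by
  have hpsd := G.posSemidef_lapMatrix ℝ
  have hfin : {μ : ℝ | μ ≠ 0 ∧ Module.End.HasEigenvalue (Matrix.toLin' (G.lapMatrix ℝ)) μ}.Finite :=
    (Module.End.finite_hasEigenvalue _).subset fun μ hμ => hμ.2
  have hne : {μ : ℝ | μ ≠ 0 ∧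
      Module.End.HasEigenvalue (Matrix.toLin' (G.lapMatrix ℝ)) μ}.Nonempty := by
    have h1 : hpsd.isHermitian.eigenvalues ≠ 0 := fun h =>
      lapMatrix_ne_zero hm hG (hpsd.isHermitian.eigenvalues_eq_zero_iff.1 h)
    obtain ⟨i, hi⟩ := Function.ne_iff.1 h1
    refine ⟨hpsd.isHermitian.eigenvalues i, hi, ?_⟩
    refine Module.End.hasEigenvalue_of_hasEigenvector
      (x := (hpsd.isHermitian.eigenvectorBasis i).ofLp) ?_
    rw [Module.End.hasEigenvector_iff, Module.End.mem_eigenspace_iff]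
    refine ⟨?_, fun h => ?_⟩
    · simpa using hpsd.isHermitian.mulVec_eigenvectorBasis i
    · have h2 := hpsd.isHermitian.eigenvectorBasis.orthonormal.ne_zero i
      exact h2 (by ext j; simp [h])
  obtain ⟨hμ0, hμ⟩ := hne.csInf_mem hfin
  refine lt_of_le_of_ne ?_ (Ne.symm hμ0)
  obtain ⟨v, hv⟩ := hμ.exists_hasEigenvector
  have h1 : (G.lapMatrix ℝ).mulVec v = lambdaMinPos (G.lapMatrix ℝ) • v := hv.apply_eq_smul
  have h2 := hpsd.dotProduct_mulVec_nonneg v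
  rw [h1, dotProduct_smul, star_trivial, smul_eq_mul] at h2
  have h3 : 0 < v ⬝ᵥ v := by
    refine lt_of_le_of_ne ?_ (Ne.symm fun h => hv.2 (dotProduct_self_eq_zero.1 h))
    exact Finset.sum_nonneg fun i _ => mul_self_nonneg (v i)
  exact nonneg_of_mul_nonneg_left h2 h3

/-- Each coordinate of `y` lies in the kernel of `L`, hence is constant over a connected graph, and
a constant with zero sum vanishes. -/
theorem eq_zero_of_kronAct_sqrtLap_eq_zero (hG : G.Connected) {y : Stack m n}
    (hy : ∑ i, y i = 0) (h : kronAct (sqrtLap G) y = 0) : y = 0 := by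
  have h1 : kronAct (G.lapMatrix ℝ) y = 0 := by
    rw [← sqrtLap_mul_self, ← kronAct_kronAct, h]
    exact map_zero (kronCLM (sqrtLap G) : Stack m n →L[ℝ] Stack m n)
  have hconst : ∀ i j, y i = y j := by
    intro i j
    ext c
    refine (G.lapMatrix_mulVec_eq_zero_iff_forall_reachable (x := fun l => y l c)).1 ?_ i j
      (hG.preconnected _ _)
    ext l
    have h2 := congrArg (fun v : Stack m n => v l c) h1
    simpa [kronAct_apply, Matrix.mulVec, dotProduct] using h2
  ext i : 1
  have hm : (m : ℝ) ≠ 0 := by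
    have := i.pos
    positivity
  have h3 : (m : ℝ) • y i = 0 := by
    rw [← hy, Finset.sum_congr rfl fun j _ => hconst j i]
    simp [Nat.cast_smul_eq_nsmul]
  exact (smul_eq_zero.1 h3).resolve_left hm

/-- An operator which maps into a finite-dimensional subspace `U` and is injective on `U` has a
bounded right inverse on `U`. -/
theorem exists_bounded_preimage {E : Type*} [NormedAddCommGroup E] [NormedSpace ℝ E]
    [FiniteDimensional ℝ E] (A : E →ₗ[ℝ] E) (U : Submodule ℝ E) (hAU : ∀ v, A v ∈ U)
    (hinj : ∀ v ∈ U, A v = 0 → v = 0) :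
    ∃ C : ℝ, 0 < C ∧ ∀ d ∈ U, ∃ y, A y = d ∧ ‖y‖ ≤ C * ‖d‖ := by
  let A' : U →ₗ[ℝ] U := A.restrict fun v _ => hAU v
  have hA : Function.Injective A' := by
    rw [← LinearMap.ker_eq_bot, LinearMap.ker_eq_bot']
    exact fun v hv => Subtype.ext (hinj v v.2 (congrArg Subtype.val hv))
  let B := (LinearEquiv.ofInjectiveEndo A' hA).toContinuousLinearEquiv
  refine ⟨‖(B.symm : U →L[ℝ] U)‖ + 1, by positivity, fun d hd => ?_⟩
  refine ⟨(B.symm ⟨d, hd⟩ : U), congrArg Subtype.val (B.apply_symm_apply ⟨d, hd⟩), ?_⟩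
  have h1 : ‖B.symm ⟨d, hd⟩‖ ≤ ‖(B.symm : U →L[ℝ] U)‖ * ‖d‖ :=
    (B.symm : U →L[ℝ] U).le_opNorm ⟨d, hd⟩
  refine h1.trans ?_
  gcongr
  linarith

/-- On vectors with zero block sum, `√L ⊗ I_n` has a bounded right inverse. -/
theorem exists_kronAct_sqrtLap_eq (n : ℕ) (hG : G.Connected) : ∃ C : ℝ, 0 < C ∧
    ∀ d : Stack m n, ∑ i, d i = 0 → ∃ y, kronAct (sqrtLap G) y = d ∧ ‖y‖ ≤ C * ‖d‖ := by
  have hU : ∀ v : Stack m n, v ∈ LinearMap.ker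
      (∑ i, (PiLp.proj 2 (𝕜 := ℝ) (fun _ : Fin m => EuclideanSpace ℝ (Fin n)) i).toLinearMap)
      ↔ ∑ i, v i = 0 := fun v => by
    simp [LinearMap.mem_ker, LinearMap.sum_apply]
  obtain ⟨C, hC, h⟩ := exists_bounded_preimage (kronCLM (sqrtLap G)).toLinearMap _
    (fun v => (hU _).2 (sum_kronAct_sqrtLap G v))
    (fun v hv h => eq_zero_of_kronAct_sqrtLap_eq_zero hG ((hU v).1 hv) h)
  exact ⟨C, hC, fun d hd => h d ((hU d).2 hd)⟩

end Laplacian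

/-- A coercive function with Lipschitz gradient on a non-trivial space has a positive Lipschitz
constant. -/
theorem lipschitz_constant_pos {E : Type*} [NormedAddCommGroup E] [InnerProductSpace ℝ E]
    [FiniteDimensional ℝ E] [Nontrivial E] {f : E → ℝ} (hf : Differentiable ℝ f)
    (hcoer : Tendsto f (cocompact E) atTop) {L : ℝ≥0} (hL : LipschitzWith L (gradient f)) :
    0 < L := by
  rw [pos_iff_ne_zero]
  rintro rfl
  obtain ⟨x, hx⟩ := hf.continuous.exists_forall_le hcoer
  have h1 : fderiv ℝ f x = 0 := IsLocalMin.fderiv_eq_zero (Eventually.of_forall hx)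
  have h2 : ∀ y, fderiv ℝ f y = 0 := by
    intro y
    have h3 := hL.dist_le_mul y x
    rw [NNReal.coe_zero, zero_mul] at h3
    rw [← toDual_gradient, dist_le_zero.1 h3, toDual_gradient, h1]
  have h3 : f = fun _ => f x := funext fun y => is_const_of_fderiv_eq_zero hf h2 y x
  rw [h3] at hcoer
  obtain ⟨y, hy⟩ := (hcoer.eventually_gt_atTop (f x)).exists
  exact lt_irrefl _ hy

/-! ### Guarantee in affine coordinates -/

section Generic

variable {E : Type*} [NormedAddCommGroup E] [InnerProductSpace ℝ E]
  {g : E → ℝ} {g' : E → E} {H : E → E →L[ℝ] E} {L ρ gs : ℝ}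

theorem IsSmoothBelow.fderiv_gradient [CompleteSpace E] (h : IsSmoothBelow g g' H L ρ gs) (x : E) :
    fderiv ℝ (gradient g) x = H x := by
  rw [gradient_eq h.hasGradient, (h.hasHessian x).fderiv]

theorem IsSmoothBelow.continuous_inner_hessian [CompleteSpace E]
    (h : IsSmoothBelow g g' H L ρ gs) (d : E) : Continuous fun x => inner ℝ d (H x d) := by
  have hH : Continuous H := by
    refine (LipschitzWith.of_dist_le_mul (K := ρ.toNNReal) fun x y => ?_).continuous
    rw [dist_eq_norm, dist_eq_norm]
    refine (h.hessian_lip x y).trans ?_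
    gcongr
    exact Real.le_coe_toNNReal ρ
  exact continuous_const.inner (hH.clm_apply continuous_const)

/-- A function bounded below with constant Hessian is convex. -/
theorem IsSmoothBelow.inner_hessian_nonneg [CompleteSpace E]
    (h : IsSmoothBelow g g' H L 0 gs) (x d : E) : 0 ≤ inner ℝ d (H x d) := by
  by_contra! hd
  have hd0 : ‖d‖ ≠ 0 := by
    intro h0
    rw [norm_eq_zero.1 h0, inner_zero_left] at hd
    exact lt_irrefl _ hd
  have hdpos : 0 < ‖d‖ := (norm_nonneg d).lt_of_ne' hd0
  set κ := -inner ℝ d (H x d) / ‖d‖ ^ 2 with hκ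
  have hκ0 : 0 < κ := div_pos (neg_pos.2 hd) (by positivity)
  have hd1 : ‖‖d‖⁻¹ • d‖ = 1 := by rw [norm_smul, norm_inv, norm_norm, inv_mul_cancel₀ hd0]
  have hcurv : inner ℝ (‖d‖⁻¹ • d) (H x (‖d‖⁻¹ • d)) ≤ -κ * ‖‖d‖⁻¹ • d‖ ^ 2 := by
    rw [map_smul, inner_smul_left, inner_smul_right, hd1, hκ, conj_trivial]
    refine le_of_eq ?_
    field_simp
  have hV : 0 ≤ g x - gs := sub_nonneg.2 (h.below x)
  -- With constant Hessian the segment may be arbitrarily long; this length forces a drop of `g x -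
  -- gs + 1`, below the infimum.
  have h1 := h.le_of_curvature le_rfl (Real.sqrt_nonneg (4 * (g x - gs + 1) / κ))
    (by linarith) hcurv hd1
  rw [Real.sq_sqrt (by positivity)] at h1
  have h2 : κ * (4 * (g x - gs + 1) / κ) / 4 = g x - gs + 1 := by field_simp
  linarith

variable [FiniteDimensional ℝ E] [MeasurableSpace E] [BorelSpace E]
  {μ : Measure E} {M2 M4 s2 : ℝ}

/-- High-probability guarantee for perturbed gradient descent on `fun x => g (z + A x)`, with a
step size which does not depend on `z`. -/
theorem IsSmoothBelow.exists_stepSize_affine (h : IsSmoothBelow g g' H L ρ gs) (hL : 0 ≤ L)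
    (hρ : 0 ≤ ρ) {A : E →L[ℝ] E} (hA : (A : E →ₗ[ℝ] E).IsSymmetric) (hμ : IsNoise μ M2 M4 s2)
    (hs2 : 0 < s2) {ε γ p c : ℝ} (hε : 0 < ε) (hγ : 0 < γ) (hp : 0 < p) (hc : 0 < c) :
    ∃ αbar : ℝ, 0 < αbar ∧ ∀ α, 0 < α → α ≤ αbar → ∀ (z : E) (good : Set E), IsClosed good →
      (∀ x, z + A x ∉ good → ε < ‖A (g' (z + A x))‖ ∨
        ∃ d, inner ℝ d ((A ∘L H (z + A x) ∘L A) d) < -γ * ‖d‖ ^ 2) →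
      ∀ {Ω : Type*} [MeasurableSpace Ω] (P : Measure Ω) [IsProbabilityMeasure P] (W : ℕ → Ω → E),
      (∀ k, Measurable (W k)) → (∀ k, P.map (W k) = μ) → IndepPast W P →
      ∀ X : ℕ → Ω → E, (∀ ω, X 0 ω = 0) →
      (∀ k ω, X (k + 1) ω = step α (fun x => A (g' (z + A x))) (X k ω) (W k ω)) →
      ∀ K : ℕ, 0 < K → g z - gs ≤ c * α ^ 2 * K →
      ENNReal.ofReal (1 - p) ≤ P {ω | ∃ k : ℕ, 0 < k ∧ k ≤ K ∧ z + A (X k ω) ∈ good} := by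
  -- The `+ 1` keeps the gradient constant positive even if `A` or `L` vanishes.
  obtain ⟨αbar, hαbar, hmain⟩ := exists_stepSize hμ hs2
    (L := ‖A‖ ^ 2 * L + 1) (ρ := ‖A‖ ^ 3 * ρ) (by positivity) (by positivity) hε hγ hp hc
  refine ⟨αbar, hαbar, ?_⟩
  intro α hα hαle z good hgood hbad Ω _ P _ W hW hlaw hind X hX0 hX K hK hKle
  have hsm := (h.comp_affine hL hρ z hA).mono (L' := ‖A‖ ^ 2 * L + 1) (by linarith)
  have hgm : MeasurableSet ((fun x => z + A x) ⁻¹' good) :=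
    (hgood.preimage (by fun_prop)).measurableSet
  have hprob := hmain α hα hαle hsm _ hgm hbad 0 K hK (by simpa only [map_zero, add_zero] using hKle)
  rw [← measure_forall_mem_eq hind hW hlaw hsm.continuous_gradient.measurable hX0 hX hgm.compl K]
    at hprob
  set S := {ω | ∀ k, 0 < k → k ≤ K → X k ω ∈ ((fun x => z + A x) ⁻¹' good)ᶜ} with hS
  have hsub : Sᶜ ⊆ {ω | ∃ k : ℕ, 0 < k ∧ k ≤ K ∧ z + A (X k ω) ∈ good} := by
    intro ω hω
    have h1 : ¬ ∀ k, 0 < k → k ≤ K → X k ω ∈ ((fun x => z + A x) ⁻¹' good)ᶜ := hω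
    push Not at h1
    obtain ⟨k, hk0, hkK, hk⟩ := h1
    exact ⟨k, hk0, hkK, not_not.1 hk⟩
  refine le_trans ?_ (measure_mono hsub)
  have h1 : 1 ≤ P S + P Sᶜ := by
    rw [← measure_univ (μ := P), ← Set.union_compl_self S]
    exact measure_union_le _ _
  rw [ENNReal.ofReal_sub _ hp.le, ENNReal.ofReal_one]
  exact tsub_le_iff_left.2 (h1.trans (add_le_add_left hprob _))

end Generic

/-! ### Return to the network iteration -/

section Network

variable {m n : ℕ} {G : SimpleGraph (Fin m)} [DecidableRel G.Adj]

/-- The gradient of the separable objective. -/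
noncomputable def stackGradient (f : Fin m → EuclideanSpace ℝ (Fin n) → ℝ) (θ : Stack m n) : Stack m n :=
  WithLp.toLp 2 fun i => gradient (f i) (θ i)

/-- The Hessian of the separable objective. -/
noncomputable def stackHessian (f : Fin m → EuclideanSpace ℝ (Fin n) → ℝ) (θ : Stack m n) :
    Stack m n →L[ℝ] Stack m n :=
  blockDiag fun i => fderiv ℝ (gradient (f i)) (θ i)

/-- In the coordinates `θ = θ0 + (√L ⊗ I_n) x`, the network iteration is perturbed gradient
descent. -/
theorem iterate_eq_add_kronAct (f : Fin m → EuclideanSpace ℝ (Fin n) → ℝ) (α : ℝ)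
    (θ0 : Stack m n) (w : ℕ → Fin m → EuclideanSpace ℝ (Fin n)) {X : ℕ → Stack m n}
    (hX0 : X 0 = 0) (hX : ∀ k, X (k + 1) = step α
      (fun x => kronCLM (sqrtLap G) (stackGradient f (θ0 + kronCLM (sqrtLap G) x))) (X k)
      (WithLp.toLp 2 (w k))) (k : ℕ) :
    iterate G f α θ0 w k = θ0 + kronCLM (sqrtLap G) (X k) := by
  induction k with
  | zero => simp only [iterate, hX0, map_zero, add_zero]
  | succ k ih =>
    have h1 : kronCLM (sqrtLap G) (kronCLM (sqrtLap G)
        (stackGradient f (θ0 + kronCLM (sqrtLap G) (X k))))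
        = kronAct (G.lapMatrix ℝ) (stackGradient f (iterate G f α θ0 w k)) := by
      rw [ih, kronCLM_apply, kronCLM_apply, kronAct_kronAct, sqrtLap_mul_self]
    have h2 : iterate G f α θ0 w (k + 1) = iterate G f α θ0 w k
        - α • (kronAct (G.lapMatrix ℝ) (stackGradient f (iterate G f α θ0 w k))
          + kronAct (sqrtLap G) (WithLp.toLp 2 (w k))) := by
      ext i : 1
      simp only [iterate, PiLp.sub_apply, PiLp.smul_apply, PiLp.add_apply, kronAct_apply,
        Finset.sum_add_distrib, stackGradient]
    rw [h2, hX, step, map_sub, map_smul, map_add, h1, ih, kronCLM_apply, kronCLM_apply]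
    abel

/-- Stacked noise vectors are independent of their predecessors. -/
theorem indepPast_stack {Ω : Type*} [MeasurableSpace Ω] {P : Measure Ω}
    {N : ℕ → Fin m → Ω → EuclideanSpace ℝ (Fin n)} (hN : ∀ k i, Measurable (N k i))
    (hind : iIndepFun (fun q : ℕ × Fin m => N q.1 q.2) P) :
    IndepPast (fun k ω => (WithLp.toLp 2 fun j => N k j ω : Stack m n)) P := by
  intro k
  have h1 := indep_iSup_of_disjoint (S := {q : ℕ × Fin m | q.1 < k})
    (T := {q : ℕ × Fin m | q.1 = k}) (fun q => (hN q.1 q.2).comap_le) hind.iIndep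
    (Set.disjoint_left.2 fun q hq hq' => (ne_of_lt hq) hq')
  have hcomap : ∀ (l : ℕ) (S : Set (ℕ × Fin m)), (∀ i, (l, i) ∈ S) →
      MeasurableSpace.comap (fun ω => (WithLp.toLp 2 fun j => N l j ω : Stack m n)) inferInstance
        ≤ ⨆ q ∈ S, MeasurableSpace.comap (N q.1 q.2) inferInstance := by
    intro l S hS
    refine Measurable.comap_le ?_
    refine (WithLp.measurable_toLp 2 _).comp
      (@measurable_pi_lambda _ _ _ (_) _ _ fun j => ?_)
    exact Measurable.of_comap_le (le_iSup₂_of_le (l, j) (hS j) le_rfl)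
  refine indep_of_indep_of_le_left (indep_of_indep_of_le_right h1 ?_) ?_
  · exact hcomap k _ fun i => rfl
  · exact iSup₂_le fun l hl => hcomap l _ fun i => hl

variable {f : Fin m → EuclideanSpace ℝ (Fin n) → ℝ} {L ρ fs : ℝ}

theorem gradient_objective
    (h : IsSmoothBelow (objective f) (stackGradient f) (stackHessian f) L ρ fs) :
    gradient (objective f) = stackGradient f :=
  gradient_eq h.hasGradient

/-- The pulled back Hessian has uniformly negative curvature wherever the second-order condition
fails. -/
theorem exists_curvature (hG : G.Connected) {γ : ℝ} (hγ : 0 ≤ γ)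
    (h : IsSmoothBelow (objective f) (stackGradient f) (stackHessian f) L ρ fs)
    (hρ : γ = 0 → ρ = 0) :
    ∃ γ0 : ℝ, 0 < γ0 ∧ ∀ (θ d : Stack m n), ∑ i, d i = 0 →
      inner ℝ d (stackHessian f θ d) < -γ * ‖d‖ ^ 2 →
      ∃ y, inner ℝ y ((kronCLM (sqrtLap G) ∘L stackHessian f θ ∘L kronCLM (sqrtLap G)) y)
        < -γ0 * ‖y‖ ^ 2 := by
  rcases hγ.eq_or_lt' with rfl | hγ0
  -- With `γ = 0` the Hessian is constant and `F` is bounded below, so no negative curvature exists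
  -- and any `γ0` serves.
  · refine ⟨1, one_pos, fun θ d _ hd => ?_⟩
    rw [hρ rfl] at h
    rw [neg_zero, zero_mul] at hd
    exact absurd hd (h.inner_hessian_nonneg θ d).not_gt
  · obtain ⟨C, hC, hinv⟩ := exists_kronAct_sqrtLap_eq (G := G) n hG
    -- With `d = (√L ⊗ I) y` both quadratic forms agree, and `‖y‖ ≤ C ‖d‖` converts the bound.
    refine ⟨γ / C ^ 2, by positivity, fun θ d hd0 hd => ?_⟩
    obtain ⟨y, rfl, hy⟩ := hinv d hd0
    refine ⟨y, ?_⟩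
    have hsymm := isSymmetric_kronCLM (n := n) (isSymm_sqrtLap G) y
      (stackHessian f θ (kronAct (sqrtLap G) y))
    simp only [ContinuousLinearMap.coe_coe, ContinuousLinearMap.comp_apply, kronCLM_apply]
      at hsymm ⊢
    rw [← hsymm]
    refine hd.trans_le ?_
    have h1 : ‖y‖ ^ 2 ≤ C ^ 2 * ‖kronAct (sqrtLap G) y‖ ^ 2 := by
      rw [← mul_pow]; gcongr
    have h2 := mul_le_mul_of_nonneg_left h1 (show 0 ≤ γ / C ^ 2 by positivity)
    have h3 : γ / C ^ 2 * (C ^ 2 * ‖kronAct (sqrtLap G) y‖ ^ 2)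
        = γ * ‖kronAct (sqrtLap G) y‖ ^ 2 := by field_simp
    linarith

theorem isClosed_secondOrderOptimal
    (h : IsSmoothBelow (objective f) (stackGradient f) (stackHessian f) L ρ fs)
    (r : EuclideanSpace ℝ (Fin n)) (ε γ : ℝ) :
    IsClosed {θ | IsSecondOrderOptimal G f r ε γ θ} := by
  have hF : Continuous (stackGradient f) := h.continuous_gradient
  have hset : {θ | IsSecondOrderOptimal G f r ε γ θ}
      = ({θ | ‖kronAct (sqrtLap G) (stackGradient f θ)‖ ≤ ε} ∩ {θ | ∑ i, θ i = r})
        ∩ ⋂ (d : Stack m n) (_ : ∑ i, d i = 0),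
          {θ | -γ * ‖d‖ ^ 2 ≤ inner ℝ d (stackHessian f θ d)} := by
    ext θ
    simp only [Set.mem_inter_iff, Set.mem_iInter]
    constructor
    · rintro ⟨h1, h2, h3⟩
      rw [gradient_objective h] at h1
      simp only [h.fderiv_gradient] at h3
      exact ⟨⟨h1, h2⟩, h3⟩
    · rintro ⟨⟨h1, h2⟩, h3⟩
      refine ⟨?_, h2, ?_⟩
      · rw [gradient_objective h]; exact h1
      · simp only [h.fderiv_gradient]; exact h3
  rw [hset]
  refine ((isClosed_le ((continuous_kronAct _).comp hF).norm continuous_const).inter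
    (isClosed_eq (by fun_prop) continuous_const)).inter
    (isClosed_iInter fun d => isClosed_iInter fun _ => isClosed_le continuous_const
      (h.continuous_inner_hessian d))

/-- High-probability second-order guarantee for the network iteration with small step size. -/
theorem exists_stepSize_network (hG : G.Connected)
    (h : IsSmoothBelow (objective f) (stackGradient f) (stackHessian f) L ρ fs) (hL : 0 ≤ L)
    (hρ : 0 ≤ ρ) {ε γ p c σ : ℝ} (hε : 0 < ε) (hγ : 0 ≤ γ) (hγρ : γ = 0 → ρ = 0) (hp : 0 < p)
    (hc : 0 < c) (hσ : 0 < σ) :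
    ∃ αbar : ℝ, 0 < αbar ∧ ∀ α, 0 < α → α ≤ αbar →
      ∀ (r : EuclideanSpace ℝ (Fin n)) (θ0 : Stack m n), ∑ i, θ0 i = r →
      ∀ {Ω : Type*} [MeasurableSpace Ω] (P : Measure Ω) [IsProbabilityMeasure P]
        (N : ℕ → Fin m → Ω → EuclideanSpace ℝ (Fin n)), (∀ k i, Measurable (N k i)) →
      (∀ k i, P.map (N k i) = multivariateGaussian 0 ((σ ^ 2) • 1)) →
      iIndepFun (fun q : ℕ × Fin m => N q.1 q.2) P →
      ∀ K : ℕ, 0 < K → objective f θ0 - fs ≤ c * α ^ 2 * K →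
      ENNReal.ofReal (1 - p) ≤ P {ω | ∃ k : ℕ, 0 < k ∧ k ≤ K ∧
        IsSecondOrderOptimal G f r ε γ (iterate G f α θ0 (fun k j => N k j ω) k)} := by
  obtain ⟨γ0, hγ0, hcurv⟩ := exists_curvature hG hγ h hγρ
  obtain ⟨αbar, hαbar, hmain⟩ := h.exists_stepSize_affine hL hρ
    (isSymmetric_kronCLM (n := n) (isSymm_sqrtLap G)) (isNoise_gaussianNoise (E := Stack m n) σ)
    (sq_pos_of_pos hσ) hε hγ0 hp hc
  refine ⟨αbar, hαbar, ?_⟩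
  intro α hα hαle r θ0 hθ0 Ω _ P _ N hN hlaw hind K hK hKle
  have hW : ∀ k, Measurable fun ω => (WithLp.toLp 2 fun j => N k j ω : Stack m n) := fun k =>
    (WithLp.measurable_toLp 2 _).comp (measurable_pi_lambda _ (hN k))
  let X : ℕ → Ω → Stack m n := fun k ω => Nat.rec 0 (fun l x => step α
    (fun x => kronCLM (sqrtLap G) (stackGradient f (θ0 + kronCLM (sqrtLap G) x))) x
    (WithLp.toLp 2 fun j => N l j ω)) k
  have hres := hmain α hα hαle θ0 {θ | IsSecondOrderOptimal G f r ε γ θ}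
    (isClosed_secondOrderOptimal h r ε γ) (fun x hx => ?_) P _ hW
    (fun k => map_toLp_eq_gaussianNoise (hN k) (hlaw k) (hind.precomp (g := Prod.mk k) (Prod.mk_right_injective k)))
    (indepPast_stack hN hind) X (fun ω => rfl) (fun k ω => rfl) K hK hKle
  · refine hres.trans (measure_mono ?_)
    rintro ω ⟨k, hk0, hkK, hk⟩
    refine ⟨k, hk0, hkK, ?_⟩
    rw [iterate_eq_add_kronAct f α θ0 _ (X := fun k => X k ω) rfl (fun k => rfl) k]
    exact hk
  · by_contra hcon
    push Not at hcon
    refine hx ⟨?_, ?_, fun d hd => ?_⟩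
    · rw [gradient_objective h]; exact hcon.1
    · have h1 := sum_kronAct_sqrtLap G x
      simp only [PiLp.add_apply, Finset.sum_add_distrib, hθ0, kronCLM_apply, h1, add_zero]
    · rw [h.fderiv_gradient]
      by_contra hlt
      obtain ⟨y, hy⟩ := hcurv _ d hd (not_le.1 hlt)
      exact (hcon.2 y).not_gt hy

end Network

end NLGD

theorem theorem1 {m n : ℕ} (hm : 2 ≤ m) (hn : 1 ≤ n)
    (G : SimpleGraph (Fin m)) [DecidableRel G.Adj] (hG : G.Connected)
    (f : Fin m → EuclideanSpace ℝ (Fin n) → ℝ)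
    (hf : ∀ i, ContDiff ℝ 2 (f i))
    (Lg LH : Fin m → ℝ≥0)
    (hLg : ∀ i, LipschitzWith (Lg i) (gradient (f i)))
    (hLH : ∀ i, LipschitzWith (LH i) (fderiv ℝ (gradient (f i))))
    (hcoer : ∀ i, Tendsto (f i) (cocompact (EuclideanSpace ℝ (Fin n))) atTop)
    (LgF LHF : ℝ)
    (hLgF : LgF = (Finset.univ.sup Lg : ℝ≥0)) (hLHF : LHF = (Finset.univ.sup LH : ℝ≥0))
    (εg εH p : ℝ) (hεg : 0 < εg)
    (hεH : εH = Real.sqrt (εg * NLGD.specNorm (NLGD.sqrtLap G) ^ 3 * LHF))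
    (hp0 : 0 < p) (hp1 : p < 1) :
    ∃ αbar : ℝ, 0 < αbar ∧
      αbar ≤ min (1 / (NLGD.specNorm (NLGD.sqrtLap G) ^ 2 * LgF))
        (-(2 * Real.log p) / (NLGD.specNorm (NLGD.sqrtLap G) ^ 2 * LgF)) ∧
      ∀ α : ℝ, 0 < α → α ≤ αbar →
      ∀ (r : EuclideanSpace ℝ (Fin n)) (θ0 : NLGD.Stack m n), ∑ i, θ0 i = r →
      ∑ i, (⨅ x, f i x) < NLGD.objective f θ0 →
      ∀ {Ω : Type*} [MeasurableSpace Ω] (P : Measure Ω) [IsProbabilityMeasure P]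
        (N : ℕ → Fin m → Ω → EuclideanSpace ℝ (Fin n)),
      (∀ k i, HasLaw (N k i)
        (multivariateGaussian 0 ((εg ^ 2 / (12 * m * n)) • (1 : Matrix (Fin n) (Fin n) ℝ))) P) →
      iIndepFun (fun q : ℕ × Fin m => N q.1 q.2) P →
      ∀ K : ℕ, K = ⌈(NLGD.objective f θ0 - ∑ i, (⨅ x, f i x)) /
        (NLGD.specNorm (NLGD.sqrtLap G) ^ 2 * LgF * εg ^ 2 * α ^ 2)⌉₊ →
      ENNReal.ofReal (1 - p) ≤ P {ω | ∃ k : ℕ, 0 < k ∧ k ≤ K ∧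
        NLGD.IsSecondOrderOptimal G f r εg (εH / NLGD.lambdaMinPos (G.lapMatrix ℝ))
          (NLGD.iterate G f α θ0 (fun k j => N k j ω) k)} := by
  have hmpos : 0 < m := by omega
  have : Nonempty (Fin n) := ⟨⟨0, hn⟩⟩
  have hbdd : ∀ i, BddBelow (Set.range (f i)) := fun i => by
    obtain ⟨x, hx⟩ := (hf i).continuous.exists_forall_le (hcoer i)
    exact ⟨f i x, Set.forall_mem_range.2 hx⟩
  have hle : ∀ i, (Lg i : ℝ) ≤ LgF := fun i => by
    rw [hLgF]; exact_mod_cast Finset.le_sup (f := Lg) (Finset.mem_univ i)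
  have hleH : ∀ i, (LH i : ℝ) ≤ LHF := fun i => by
    rw [hLHF]; exact_mod_cast Finset.le_sup (f := LH) (Finset.mem_univ i)
  -- Coercivity excludes constant functions, so the denominators of the step-size bound and of `K`
  -- are genuinely positive.
  have hLgF0 : 0 < LgF :=
    lt_of_lt_of_le (NNReal.coe_pos.2 (NLGD.lipschitz_constant_pos
      ((hf ⟨0, hmpos⟩).differentiable (by norm_num)) (hcoer _) (hLg _))) (hle ⟨0, hmpos⟩)
  have hLHF0 : 0 ≤ LHF := by rw [hLHF]; exact NNReal.coe_nonneg _
  have hsm : NLGD.IsSmoothBelow (NLGD.objective f) (NLGD.stackGradient f) (NLGD.stackHessian f)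
      LgF LHF (∑ i, ⨅ x, f i x) :=
    NLGD.isSmoothBelow_sum
      (fun i => NLGD.isSmoothBelow_of_contDiff (hf i) (hLg i) (hLH i) (hbdd i))
      hLgF0.le hLHF0 hle hleH
  have hS := NLGD.specNorm_sqrtLap_pos hm hG
  have hlam := NLGD.lambdaMinPos_lapMatrix_pos hm hG
  have hγ : 0 ≤ εH / NLGD.lambdaMinPos (G.lapMatrix ℝ) := by
    rw [hεH]; positivity
  have hγρ : εH / NLGD.lambdaMinPos (G.lapMatrix ℝ) = 0 → LHF = 0 := fun h0 => by
    by_contra hne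
    have hLpos : 0 < LHF := lt_of_le_of_ne hLHF0 (Ne.symm hne)
    have hpos : 0 < εH / NLGD.lambdaMinPos (G.lapMatrix ℝ) := by
      rw [hεH]; positivity
    exact hpos.ne' h0
  have hmr : (0 : ℝ) < m := by exact_mod_cast hmpos
  have hnr : (0 : ℝ) < n := by exact_mod_cast hn
  have hvar : 0 < εg ^ 2 / (12 * m * n) := by positivity
  obtain ⟨a, ha, hmain⟩ := NLGD.exists_stepSize_network hG hsm hLgF0.le hLHF0 hεg hγ hγρ hp0
    (show 0 < NLGD.specNorm (NLGD.sqrtLap G) ^ 2 * LgF * εg ^ 2 by positivity)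
    (Real.sqrt_pos.2 hvar)
  rw [Real.sq_sqrt hvar.le] at hmain
  have hlog : 0 < -(2 * Real.log p) := by linarith [Real.log_neg hp0 hp1]
  -- The two explicit bounds are simply imposed; the probabilistic argument needs only `α ≤ a`.
  refine ⟨min a (min (1 / (NLGD.specNorm (NLGD.sqrtLap G) ^ 2 * LgF))
    (-(2 * Real.log p) / (NLGD.specNorm (NLGD.sqrtLap G) ^ 2 * LgF))), ?_, min_le_right _ _, ?_⟩
  · exact lt_min ha (lt_min (by positivity) (div_pos hlog (by positivity)))
  intro α hα hαle r θ0 hθ0 hlt Ω _ P _ N hN hind K hK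
  have hpos : 0 < (NLGD.objective f θ0 - ∑ i, (⨅ x, f i x)) /
      (NLGD.specNorm (NLGD.sqrtLap G) ^ 2 * LgF * εg ^ 2 * α ^ 2) :=
    div_pos (sub_pos.2 hlt) (by positivity)
  have hK0 : 0 < K := by rw [hK]; exact Nat.ceil_pos.2 hpos
  have hKle : NLGD.objective f θ0 - ∑ i, (⨅ x, f i x)
      ≤ NLGD.specNorm (NLGD.sqrtLap G) ^ 2 * LgF * εg ^ 2 * α ^ 2 * K := by
    rw [← div_le_iff₀' (by positivity), hK]
    exact Nat.le_ceil _
  -- `HasLaw` gives only a.e. measurability; countably many modifications change the event by a null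
  -- set.
  have hae : ∀ k i, N k i =ᵐ[P] (hN k i).aemeasurable.mk (N k i) :=
    fun k i => (hN k i).aemeasurable.ae_eq_mk
  have hres := hmain α hα (hαle.trans (min_le_left _ _)) r θ0 hθ0 P
    (fun k i => (hN k i).aemeasurable.mk (N k i)) (fun k i => (hN k i).aemeasurable.measurable_mk)
    (fun k i => by rw [← Measure.map_congr (hae k i)]; exact (hN k i).map_eq)
    (hind.congr fun q => hae q.1 q.2) K hK0 hKle
  refine hres.trans (measure_mono_ae ?_)
  filter_upwards [ae_all_iff.2 fun k => ae_all_iff.2 fun i => hae k i] with ω hω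
  rintro ⟨k, hk0, hkK, hk⟩
  refine ⟨k, hk0, hkK, ?_⟩
  simp only [hω]
  exact hk
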